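/- Let $\mathbb{D}$ be the open unit disc, $m$ normalized Lebesgue measure on $\partial\mathbb{D}$, and $\|\cdot\|_p$ the norm of $L^p(m)$. Let $f$ be an inner function, that is, an analytic map $f:\mathbb{D}\to\mathbb{D}$ such that the radial limit $f(z)=\lim_{r\to1^-}f(rz)$ exists and has modulus one for $m$-almost every $z\in\partial\mathbb{D}$. Assume that $f(0)=0$ and that $f$ is not a rotation. Denote by $f^n$ the $n$-th iterate of $f$, both in $\mathbb{D}$ and almost everywhere on $\partial\mathbb{D}$. Then $|f'(0)|<1$. Let $\{a_n\}_{n\ge1}$ be complex numbers with $\sum_{n=1}^\infty|a_n|^2<\infty$. Then the series $$\xi=\sum_{n=1}^\infty a_nf^n$$ converges in $L^2(m)$, its sum being the boundary function of the analytic function $\sum_{n\ge1} a_nf^n$ in $\mathbb{D}$ (that is, for each $w\in\mathbb{D}$ the series $\sum_{n\ge1} a_nf^n(w)$ converges to the Poisson integral of $\xi$ at $w$), the series in $$\sigma^2=\sum_{n=1}^\infty|a_n|^2+2\,\mathrm{Re}\sum_{k=1}^\infty f'(0)^k\sum_{n=1}^\infty\overline{a_n}\,a_{n+k}$$ converge absolutely,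 and the following hold. (a) $\|\xi\|_2^2=\sigma^2$ and $$C_0^{-1}\sum_{n=1}^\infty|a_n|^2\le\sigma^2\le C_0\sum_{n=1}^\infty|a_n|^2,\qquad C_0=\frac{1+|f'(0)|}{1-|f'(0)|}.$$ (b) For every $t\in\mathbb{C}$, $$\int_{\partial\mathbb{D}}\langle t,\xi\rangle^2\,dm=\tfrac12|t|^2\sigma^2,\qquad\text{where }\langle t,z\rangle=\mathrm{Re}(\overline t z).$$ (c) There is a constant $C=C(f)>0$, depending only on $f$ and not on the sequence $\{a_n\}$, such that $\|\xi\|_4\le C\|\xi\|_2$. -/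

import Mathlib

open MeasureTheory Filter Topology

/-- Normalized Lebesgue measure `m` on the unit circle, as a Borel measure on `ℂ` carried by the
circle: the image of `dθ / 2π` on `(0, 2π]` under `θ ↦ exp (i θ)`. -/
noncomputable def circleMeasure : Measure ℂ :=
  Measure.map (circleMap 0 1)
    (ENNReal.ofReal (2 * Real.pi)⁻¹ • volume.restrict (Set.Ioc 0 (2 * Real.pi)))

/-- Inner functions: analytic maps of the unit disc into itself whose radial limits exist and have
modulus one at almost every point of the unit circle. Values outside the disc are irrelevant. -/
structure IsInnerFunction (f : ℂ → ℂ) : Prop where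
  differentiableOn : DifferentiableOn ℂ f (Metric.ball 0 1)
  mapsTo : Set.MapsTo f (Metric.ball 0 1) (Metric.ball 0 1)
  radial : ∀ᵐ z ∂circleMeasure, ∃ L : ℂ, ‖L‖ = 1 ∧
    Tendsto (fun r : ℝ => f (r * z)) (𝓝[<] 1) (𝓝 L)

/-- `f` is a rotation of the unit disc. -/
def IsRotation (f : ℂ → ℂ) : Prop :=
  ∃ c : ℂ, ‖c‖ = 1 ∧ ∀ w ∈ Metric.ball (0 : ℂ) 1, f w = c * w

/-- The boundary mapping `f(z) = lim_{r → 1⁻} f(rz)` (defined almost everywhere on the circle). -/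
noncomputable def boundaryMap (f : ℂ → ℂ) (z : ℂ) : ℂ :=
  limUnder (𝓝[<] (1 : ℝ)) fun r : ℝ => f (r * z)

/-- `ξ = ∑_{n ≥ 1} a_n f^n` on the unit circle: `ξ` is in `L²(m)` and the partial sums
`∑_{n=1}^N a_n f^n` of iterates of the boundary mapping converge to `ξ` in `L²(m)`. -/
def HasBoundarySum (f : ℂ → ℂ) (a : ℕ → ℂ) (ξ : ℂ → ℂ) : Prop :=
  MemLp ξ 2 circleMeasure ∧
    Tendsto
      (fun N : ℕ => eLpNorm
        (fun z => ξ z - ∑ n ∈ Finset.Icc 1 N, a n * (boundaryMap f)^[n] z) 2 circleMeasure)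
      atTop (𝓝 0)

/-- The Poisson integral of `ξ` at the point `w` of the unit disc. -/
noncomputable def poissonExtension (ξ : ℂ → ℂ) (w : ℂ) : ℂ :=
  ∫ z, poissonKernel 0 w z • ξ z ∂circleMeasure

/-- The `k`-th correlation `∑_{n ≥ 1} conj(a_n) a_{n+k}`. -/
noncomputable def correlation (a : ℕ → ℂ) (k : ℕ) : ℂ :=
  ∑' n : ℕ, (starRingEnd ℂ) (a (n + 1)) * a (n + 1 + k)

/-- `σ² = ∑_{n ≥ 1} |a_n|² + 2 Re ∑_{k ≥ 1} l^k ∑_{n ≥ 1} conj(a_n) a_{n+k}`. -/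
noncomputable def sigmaSq (l : ℂ) (a : ℕ → ℂ) : ℝ :=
  (∑' n : ℕ, ‖a (n + 1)‖ ^ 2) + 2 * (∑' k : ℕ, l ^ (k + 1) * correlation a (k + 1)).re

/-! Write `l` for `f'(0)` and `T` for the boundary map. `T` preserves `m`, and the conditional
expectation of the identity given `T` is `conj l * T`. Both facts come from moments. Bounded
analytic functions are the Poisson integrals of their radial limits, so integrals of `T ^ j`, `z * T
^ j` and `conj z * T ^ j` are values at the origin of `f ^ j`, `z * f ^ j` and `(f / z) * f ^ (j -
1)` (the last for `j ≥ 1`). A finite measure on the circle is determined by such moments.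

Hence `z - conj l * T z` is orthogonal to every bounded function of `T z`: its compositions with the
iterates of `T` are reversed martingale differences. Solving `c (n+1) - conj l * c n = b (n+1)`, `c
0 = b 0`, turns a partial sum of `b n * T^[n+1]` into a combination of these differences with
coefficients `c`. Orthogonality gives its L² norm exactly, and the ℓ² norms of `b` and `c` are
comparable because `|l| < 1`. This yields L² convergence and the lower bound for `σ²`. The fourth
moment is bounded by induction: in `|d + s|⁴` the term linear in the new difference `d` integrates
to zero, and the rest is controlled by `|d| ≤ 2 |c|`.

The formula for `σ²` comes from `∫ T^[n+k] * conj T^[n] = l ^ k`, and (b) from the vanishing of the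
same integrals without the conjugate. Both pass to the limit in L²; the L⁴ bound passes by
convergence in measure and Fatou. -/

open scoped BoundedContinuousFunction ComplexConjugate ENNReal

/-! ### Measures on the circle and their moments -/

/-- A finite measure on the circle is determined by its nonnegative Fourier coefficients. -/
theorem Circle.measure_ext_of_integral_pow [MeasurableSpace Circle] [BorelSpace Circle]
    {μ ν : Measure Circle} [IsFiniteMeasure μ] [IsFiniteMeasure ν]
    (h : ∀ j : ℕ, ∫ z, (z : ℂ) ^ j ∂μ = ∫ z, (z : ℂ) ^ j ∂ν) : μ = ν := by
  have hc (j : ℤ) : Continuous fun z : Circle => ((z ^ j : Circle) : ℂ) :=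
    continuous_subtype_val.comp (continuous_zpow (G := Circle) j)
  let ψ : ℤ → (Circle →ᵇ ℂ) := fun j => BoundedContinuousFunction.mkOfCompact ⟨_, hc j⟩
  have hψ (j : ℤ) (z : Circle) : ψ j z = ((z ^ j : Circle) : ℂ) := rfl
  -- On the circle conjugation inverts, so the star algebra generated by `z` consists of Laurent
  -- polynomials and integrals over it reduce to powers.
  have hmem : ∀ g ∈ StarAlgebra.adjoin ℂ {ψ 1}, g ∈ Submodule.span ℂ (Set.range ψ) := by
    intro g hg
    induction hg using StarAlgebra.adjoin_induction with
    | mem x hx => exact Submodule.subset_span ⟨1, hx.symm⟩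
    | algebraMap r =>
      have : algebraMap ℂ (Circle →ᵇ ℂ) r = r • ψ 0 := by
        ext z; simp [hψ]
      rw [this]
      exact Submodule.smul_mem _ _ (Submodule.subset_span ⟨0, rfl⟩)
    | add x y _ _ hx hy => exact add_mem hx hy
    | mul x y hxA hyA hx hy =>
      clear hxA hyA
      induction hx, hy using Submodule.span_induction₂ with
      | mem_mem x y hx hy =>
        obtain ⟨i, rfl⟩ := hx
        obtain ⟨j, rfl⟩ := hy
        refine Submodule.subset_span ⟨i + j, ?_⟩
        ext z; simp [hψ, zpow_add]
      | zero_left => simp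
      | zero_right => simp
      | add_left _ _ _ _ _ _ h1 h2 => rw [add_mul]; exact add_mem h1 h2
      | add_right _ _ _ _ _ _ h1 h2 => rw [mul_add]; exact add_mem h1 h2
      | smul_left _ _ _ _ _ h1 => rw [smul_mul_assoc]; exact Submodule.smul_mem _ _ h1
      | smul_right _ _ _ _ _ h1 => rw [mul_smul_comm]; exact Submodule.smul_mem _ _ h1
    | star x hxA hx =>
      clear hxA
      induction hx using Submodule.span_induction with
      | mem x hx =>
        obtain ⟨i, rfl⟩ := hx
        refine Submodule.subset_span ⟨-i, ?_⟩
        ext z; simp [hψ, ← Circle.coe_inv_eq_conj]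
      | zero => simp
      | add _ _ _ _ h1 h2 => rw [star_add]; exact add_mem h1 h2
      | smul _ _ _ h1 => rw [star_smul]; exact Submodule.smul_mem _ _ h1
  refine ext_of_forall_mem_subalgebra_integral_eq_of_polish (𝕜 := ℂ)
    (A := StarAlgebra.adjoin ℂ {ψ 1}) ?_ ?_
  · intro x y hxy
    refine ⟨fun z => ψ 1 z, ⟨BoundedContinuousFunction.toContinuousMapStarₐ ℂ (ψ 1),
      ⟨ψ 1, StarAlgebra.subset_adjoin ℂ _ rfl, rfl⟩, rfl⟩, ?_⟩
    simpa [hψ] using fun h => hxy (Subtype.ext h)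
  · intro g hg
    have hg' := hmem g hg
    clear hg
    induction hg' using Submodule.span_induction with
    | mem x hx =>
      obtain ⟨i, rfl⟩ := hx
      obtain ⟨n, rfl | rfl⟩ := i.eq_nat_or_neg
      · simpa [hψ] using h n
      -- Negative moments are conjugates of positive ones since the measures are real.
      · have := congrArg conj (h n)
        rw [← integral_conj, ← integral_conj] at this
        simpa [hψ, ← Circle.coe_inv_eq_conj] using this
    | zero => simp
    | add x y _ _ h1 h2 =>
      have hi (μ : Measure Circle) [IsFiniteMeasure μ] (x : Circle →ᵇ ℂ) : Integrable x μ :=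
        x.integrable μ
      simp only [BoundedContinuousFunction.coe_add, Pi.add_apply]
      rw [integral_add (hi μ x) (hi μ y), integral_add (hi ν x) (hi ν y), h1, h2]
    | smul c x _ h1 =>
      simp only [BoundedContinuousFunction.coe_smul, integral_smul, h1]

/-- A finite measure on `ℂ` carried by the unit circle is determined by its moments. -/
theorem measure_ext_of_integral_pow {μ ν : Measure ℂ} [IsFiniteMeasure μ] [IsFiniteMeasure ν]
    (hμ : ∀ᵐ z ∂μ, ‖z‖ = 1) (hν : ∀ᵐ z ∂ν, ‖z‖ = 1)
    (h : ∀ j : ℕ, ∫ z, z ^ j ∂μ = ∫ z, z ^ j ∂ν) : μ = ν := by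
  let _ : MeasurableSpace Circle := borel Circle
  have : BorelSpace Circle := ⟨rfl⟩
  let c : Circle → ℂ := fun z => z
  have hrange : Set.range c = Metric.sphere 0 1 := by
    ext z
    refine ⟨fun ⟨y, hy⟩ => hy ▸ by simpa [c] using y.norm_coe, fun hz => ⟨⟨z, ?_⟩, rfl⟩⟩
    simpa [Submonoid.unitSphere] using hz
  have hc : IsEmbedding c := IsEmbedding.subtypeVal
  have hemb : MeasurableEmbedding c :=
    hc.measurableEmbedding (hrange ▸ Metric.isClosed_sphere.measurableSet)
  have key (ρ : Measure ℂ) (hρ : ∀ᵐ z ∂ρ, ‖z‖ = 1) : Measure.map c (ρ.comap c) = ρ := by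
    rw [hemb.map_comap, hrange]
    exact Measure.restrict_eq_self_of_ae_mem (by simpa using hρ)
  have hfin (ρ : Measure ℂ) [IsFiniteMeasure ρ] :
      IsFiniteMeasure (ρ.comap c) := by
    refine ⟨?_⟩
    rw [hemb.comap_apply]
    exact measure_lt_top _ _
  have := hfin μ
  have := hfin ν
  rw [← key μ hμ, ← key ν hν]
  congr 1
  refine Circle.measure_ext_of_integral_pow fun j => ?_
  have := h j
  rw [← key μ hμ, ← key ν hν, hemb.integral_map, hemb.integral_map] at this
  exact this

/-! ### Normalized arc length and Poisson integrals -/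

theorem aemeasurable_circleMap {μ : Measure ℝ} : AEMeasurable (circleMap 0 1) μ :=
  (continuous_circleMap 0 1).measurable.aemeasurable

instance isProbabilityMeasure_circleMeasure : IsProbabilityMeasure circleMeasure := by
  have : IsProbabilityMeasure
      (ENNReal.ofReal (2 * Real.pi)⁻¹ • volume.restrict (Set.Ioc 0 (2 * Real.pi))) := by
    refine ⟨?_⟩
    simp only [Measure.smul_apply, Measure.restrict_apply_univ, Real.volume_Ioc, smul_eq_mul,
      sub_zero]
    rw [← ENNReal.ofReal_mul (by positivity), inv_mul_cancel₀ (by positivity), ENNReal.ofReal_one]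
  exact Measure.isProbabilityMeasure_map aemeasurable_circleMap

theorem ae_norm_eq_one_circleMeasure : ∀ᵐ z ∂circleMeasure, ‖z‖ = 1 := by
  unfold circleMeasure
  refine (ae_map_iff aemeasurable_circleMap ?_).2 (by simp)
  exact measurableSet_eq_fun measurable_norm measurable_const

theorem ContinuousOn.aestronglyMeasurable_circleMeasure {g : ℂ → ℂ}
    (hg : ContinuousOn g (Metric.sphere 0 1)) : AEStronglyMeasurable g circleMeasure := by
  have : circleMeasure.restrict (Metric.sphere 0 1) = circleMeasure :=
    Measure.restrict_eq_self_of_ae_mem (by simpa using ae_norm_eq_one_circleMeasure)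
  rw [← this]
  exact hg.aestronglyMeasurable Metric.isClosed_sphere.measurableSet

theorem integral_circleMeasure {g : ℂ → ℂ} (hg : AEStronglyMeasurable g circleMeasure) :
    ∫ z, g z ∂circleMeasure = Real.circleAverage g 0 1 := by
  unfold circleMeasure at hg ⊢
  rw [integral_map aemeasurable_circleMap hg, integral_smul_measure, Real.circleAverage_def,
    intervalIntegral.integral_of_le (by positivity), ENNReal.toReal_ofReal (by positivity)]

theorem measurable_poissonKernel (w : ℂ) : Measurable (poissonKernel 0 w) := by
  unfold poissonKernel
  fun_prop

theorem poissonKernel_nonneg_of_norm_eq_one {w z : ℂ} (hw : w ∈ Metric.ball (0 : ℂ) 1)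
    (hz : ‖z‖ = 1) : 0 ≤ poissonKernel 0 w z := by
  have : ‖w‖ < 1 := by simpa using hw
  rw [poissonKernel_def]
  have : ‖w‖ ^ 2 ≤ 1 := pow_le_one₀ (norm_nonneg _) this.le
  simp only [sub_zero, hz]
  exact div_nonneg (by linarith) (by positivity)

theorem poissonKernel_le_of_norm_eq_one {w z : ℂ} (hw : w ∈ Metric.ball (0 : ℂ) 1)
    (hz : ‖z‖ = 1) : poissonKernel 0 w z ≤ (1 + ‖w‖) / (1 - ‖w‖) := by
  rw [poissonKernel_eq_re_herglotzRieszKernel]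
  simpa [herglotzRieszKernel_def] using
    re_herglotzRieszKernel_le (c := 0) (R := 1) (z := z) (by simpa using hz) hw

theorem norm_poissonKernel_le_of_norm_eq_one {w z : ℂ} (hw : w ∈ Metric.ball (0 : ℂ) 1)
    (hz : ‖z‖ = 1) : ‖poissonKernel 0 w z‖ ≤ (1 + ‖w‖) / (1 - ‖w‖) := by
  rw [Real.norm_of_nonneg (poissonKernel_nonneg_of_norm_eq_one hw hz)]
  exact poissonKernel_le_of_norm_eq_one hw hz

/-- Bounded analytic functions are the Poisson integrals of their radial limits. -/
theorem poissonExtension_eq_of_tendsto_radial {g G : ℂ → ℂ} {M : ℝ}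
    (hg : DifferentiableOn ℂ g (Metric.ball 0 1)) (hM : ∀ w ∈ Metric.ball (0 : ℂ) 1, ‖g w‖ ≤ M)
    (hG : ∀ᵐ z ∂circleMeasure, Tendsto (fun r : ℝ => g (r * z)) (𝓝[<] 1) (𝓝 (G z)))
    {w : ℂ} (hw : w ∈ Metric.ball (0 : ℂ) 1) : poissonExtension G w = g w := by
  have hev : ∀ᶠ r : ℝ in 𝓝[<] 1, r ∈ Set.Ioo 0 1 := Ioo_mem_nhdsLT one_pos
  have hmaps {r : ℝ} (hr : r ∈ Set.Ioo 0 1) {z : ℂ} (hz : ‖z‖ ≤ 1) :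
      (r * z : ℂ) ∈ Metric.ball (0 : ℂ) 1 := by
    have : r * ‖z‖ < 1 := by nlinarith [hr.1, hr.2, norm_nonneg z]
    simpa [abs_of_pos hr.1] using this
  have hdc {r : ℝ} (hr : r ∈ Set.Ioo 0 1) :
      DifferentiableOn ℂ (fun z : ℂ => g (r * z)) (Metric.closedBall 0 1) :=
    hg.comp (by fun_prop) fun z hz => hmaps hr (by simpa using hz)
  have hmeas {r : ℝ} (hr : r ∈ Set.Ioo 0 1) :
      AEStronglyMeasurable (fun z : ℂ => poissonKernel 0 w z • g (r * z)) circleMeasure :=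
    (measurable_poissonKernel w).aestronglyMeasurable.smul
      ((hdc hr).continuousOn.mono
        Metric.sphere_subset_closedBall).aestronglyMeasurable_circleMeasure
  -- The dilate of `g` by `r < 1` is analytic up to the boundary, where the classical Poisson
  -- formula holds; the kernel is bounded for fixed `w`, so `r → 1` by dominated convergence.
  have hint {r : ℝ} (hr : r ∈ Set.Ioo 0 1) :
      ∫ z, poissonKernel 0 w z • g (r * z) ∂circleMeasure = g (r * w) := by
    rw [integral_circleMeasure (hmeas hr)]
    refine DiffContOnCl.circleAverage_poissonKernel_smul (f := fun z => g (r * z)) ?_ hw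
    exact (hdc hr).diffContOnCl_ball subset_rfl
  have h1 : Tendsto (fun r : ℝ => ∫ z, poissonKernel 0 w z • g (r * z) ∂circleMeasure) (𝓝[<] 1)
      (𝓝 (poissonExtension G w)) := by
    refine tendsto_integral_filter_of_dominated_convergence
      (fun _ => (1 + ‖w‖) / (1 - ‖w‖) * M) ?_ ?_ (integrable_const _) ?_
    · filter_upwards [hev] with r hr using hmeas hr
    · filter_upwards [hev] with r hr
      filter_upwards [ae_norm_eq_one_circleMeasure] with z hz
      rw [norm_smul]
      exact mul_le_mul (norm_poissonKernel_le_of_norm_eq_one hw hz) (hM _ (hmaps hr hz.le))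
        (norm_nonneg _) ((norm_nonneg _).trans (norm_poissonKernel_le_of_norm_eq_one hw hz))
    · filter_upwards [hG] with z hz using hz.const_smul _
  have h2 : Tendsto (fun r : ℝ => g (r * w)) (𝓝[<] 1) (𝓝 (g w)) := by
    have hc : ContinuousAt g w :=
      (hg.differentiableAt (Metric.isOpen_ball.mem_nhds hw)).continuousAt
    have : Tendsto (fun r : ℝ => (r : ℂ) * w) (𝓝[<] 1) (𝓝 w) := by
      have : Continuous fun r : ℝ => (r : ℂ) * w := by fun_prop
      simpa using (this.tendsto 1).mono_left nhdsWithin_le_nhds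
    exact hc.tendsto.comp this
  refine tendsto_nhds_unique h1 (h2.congr' ?_)
  filter_upwards [hev] with r hr using (hint hr).symm

/-! ### Boundary maps and transport of densities -/

/-- The boundary mapping of an inner function has a Borel measurable version with values in the
circle. -/
theorem IsInnerFunction.exists_measurable_boundaryMap {f : ℂ → ℂ} (hf : IsInnerFunction f) :
    ∃ T : ℂ → ℂ, Measurable T ∧ (∀ z, ‖T z‖ = 1) ∧ T =ᵐ[circleMeasure] boundaryMap f ∧
      ∀ᵐ z ∂circleMeasure, Tendsto (fun r : ℝ => f (r * z)) (𝓝[<] 1) (𝓝 (T z)) := by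
  have hlim : ∀ᵐ z ∂circleMeasure, ‖boundaryMap f z‖ = 1 ∧
      Tendsto (fun r : ℝ => f (r * z)) (𝓝[<] 1) (𝓝 (boundaryMap f z)) := by
    filter_upwards [hf.radial] with z ⟨L, hL, hz⟩
    rw [boundaryMap, hz.limUnder_eq]
    exact ⟨hL, hz⟩
  obtain ⟨u, -, hu1, hu⟩ := exists_seq_strictMono_tendsto' (zero_lt_one (α := ℝ))
  have hu' : Tendsto u atTop (𝓝[<] 1) :=
    tendsto_nhdsWithin_iff.2 ⟨hu, .of_forall fun n => (hu1 n).2⟩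
  have hmeas : AEMeasurable (boundaryMap f) circleMeasure := by
    refine aemeasurable_of_tendsto_metrizable_ae atTop (f := fun n z => f (u n * z))
      (fun n => ?_) ?_
    · refine (ContinuousOn.aestronglyMeasurable_circleMeasure ?_).aemeasurable
      refine hf.differentiableOn.continuousOn.comp (by fun_prop) fun z hz => ?_
      have : ‖z‖ = 1 := by simpa using hz
      simpa [this, abs_of_pos (hu1 n).1] using (hu1 n).2
    · filter_upwards [hlim] with z hz using hz.2.comp hu'
  have hs : MeasurableSet {z | ‖hmeas.mk _ z‖ = 1} :=
    measurableSet_eq_fun hmeas.measurable_mk.norm measurable_const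
  classical
  -- The default value 1 on the null set makes the modulus one everywhere, so iterates never leave
  -- the circle.
  have hT : (fun z => if ‖hmeas.mk _ z‖ = 1 then hmeas.mk _ z else 1)
      =ᵐ[circleMeasure] boundaryMap f := by
    filter_upwards [hmeas.ae_eq_mk, hlim] with z hz h1
    rw [← hz, if_pos h1.1]
  refine ⟨_, Measurable.ite hs hmeas.measurable_mk measurable_const, fun z => ?_, hT, ?_⟩
  · split_ifs with h
    · exact h
    · simp
  · filter_upwards [hT, hlim] with z hz h1
    rw [hz]
    exact h1.2

theorem isInnerFunction_id : IsInnerFunction id := by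
  refine ⟨differentiableOn_id, Set.mapsTo_id _, ?_⟩
  filter_upwards [ae_norm_eq_one_circleMeasure] with z hz
  refine ⟨z, hz, ?_⟩
  have : Continuous fun r : ℝ => (r : ℂ) * z := by fun_prop
  simpa using (this.tendsto 1).mono_left nhdsWithin_le_nhds

theorem tendsto_radial_id (z : ℂ) : Tendsto (fun r : ℝ => id (r * z : ℂ)) (𝓝[<] 1) (𝓝 z) := by
  have : Continuous fun r : ℝ => (r : ℂ) * z := by fun_prop
  simpa using (this.tendsto 1).mono_left nhdsWithin_le_nhds

theorem integrable_circleMeasure_of_norm_le {E : Type*} [NormedAddCommGroup E] {g : ℂ → E} {M : ℝ}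
    (hg : AEStronglyMeasurable g circleMeasure) (hM : ∀ z, ‖z‖ = 1 → ‖g z‖ ≤ M) :
    Integrable g circleMeasure := by
  refine Integrable.of_bound hg M ?_
  filter_upwards [ae_norm_eq_one_circleMeasure] with z hz using hM z hz

theorem integral_withDensity_circleMeasure {h : ℂ → ℝ} (hh : Measurable h)
    (h0 : ∀ z, ‖z‖ = 1 → 0 ≤ h z) (g : ℂ → ℂ) :
    ∫ z, g z ∂(circleMeasure.withDensity fun z => ENNReal.ofReal (h z)) =
      ∫ z, h z • g z ∂circleMeasure := by
  rw [integral_withDensity_eq_integral_toReal_smul hh.ennreal_ofReal (by simp)]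
  refine integral_congr_ae ?_
  filter_upwards [ae_norm_eq_one_circleMeasure] with z hz
  rw [ENNReal.toReal_ofReal (h0 z hz)]

/-- If the moments of `T` with respect to the density `h` are the moments of the density `k`, then
`T` pushes the first density to the second. -/
theorem map_withDensity_circleMeasure {h k : ℂ → ℝ} {T : ℂ → ℂ} (hh : Measurable h)
    (hk : Measurable k) (h0 : ∀ z, ‖z‖ = 1 → 0 ≤ h z) (k0 : ∀ z, ‖z‖ = 1 → 0 ≤ k z)
    {M : ℝ} (hM : ∀ z, ‖z‖ = 1 → ‖h z‖ ≤ M) (kM : ∀ z, ‖z‖ = 1 → ‖k z‖ ≤ M)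
    (hT : Measurable T) (hT1 : ∀ z, ‖T z‖ = 1)
    (hmom : ∀ j : ℕ, ∫ z, h z • T z ^ j ∂circleMeasure = ∫ z, k z • z ^ j ∂circleMeasure) :
    (circleMeasure.withDensity fun z => ENNReal.ofReal (h z)).map T =
      circleMeasure.withDensity fun z => ENNReal.ofReal (k z) := by
  have hfin {h : ℂ → ℝ} (hh : Measurable h) (hM : ∀ z, ‖z‖ = 1 → ‖h z‖ ≤ M) :
      IsFiniteMeasure (circleMeasure.withDensity fun z => ENNReal.ofReal (h z)) :=
    isFiniteMeasure_withDensity_ofReal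
      (integrable_circleMeasure_of_norm_le hh.aestronglyMeasurable hM).2
  have := hfin hh hM
  have := hfin hk kM
  refine measure_ext_of_integral_pow ?_ ?_ fun j => ?_
  · exact (ae_map_iff hT.aemeasurable (measurableSet_eq_fun measurable_norm measurable_const)).2
      (.of_forall hT1)
  · exact (withDensity_absolutelyContinuous _ _).ae_le ae_norm_eq_one_circleMeasure
  · rw [integral_map hT.aemeasurable (by fun_prop),
      integral_withDensity_circleMeasure hh h0, integral_withDensity_circleMeasure hk k0, hmom]

theorem integral_smul_comp_circleMeasure {h k : ℂ → ℝ} {T : ℂ → ℂ} (hh : Measurable h)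
    (hk : Measurable k) (h0 : ∀ z, ‖z‖ = 1 → 0 ≤ h z) (k0 : ∀ z, ‖z‖ = 1 → 0 ≤ k z)
    {M : ℝ} (hM : ∀ z, ‖z‖ = 1 → ‖h z‖ ≤ M) (kM : ∀ z, ‖z‖ = 1 → ‖k z‖ ≤ M)
    (hT : Measurable T) (hT1 : ∀ z, ‖T z‖ = 1)
    (hmom : ∀ j : ℕ, ∫ z, h z • T z ^ j ∂circleMeasure = ∫ z, k z • z ^ j ∂circleMeasure)
    {g : ℂ → ℂ} (hg : Measurable g) :
    ∫ z, h z • g (T z) ∂circleMeasure = ∫ z, k z • g z ∂circleMeasure := by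
  rw [← integral_withDensity_circleMeasure hk k0,
    ← map_withDensity_circleMeasure hh hk h0 k0 hM kM hT hT1 hmom,
    integral_map hT.aemeasurable hg.aestronglyMeasurable,
    integral_withDensity_circleMeasure hh h0]

/-! ### Harmonic measure, Löwner's lemma and the conditional expectation -/

section RadialLimit

variable {f T : ℂ → ℂ}

theorem poissonExtension_pow (hf : IsInnerFunction f)
    (hr : ∀ᵐ z ∂circleMeasure, Tendsto (fun r : ℝ => f (r * z)) (𝓝[<] 1) (𝓝 (T z)))
    {w : ℂ} (hw : w ∈ Metric.ball (0 : ℂ) 1) (j : ℕ) :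
    poissonExtension (fun z => T z ^ j) w = f w ^ j := by
  refine poissonExtension_eq_of_tendsto_radial (g := fun z => f z ^ j) (M := 1)
    (hf.differentiableOn.pow j) (fun w hw => ?_) ?_ hw
  · have : ‖f w‖ < 1 := by simpa using hf.mapsTo hw
    rw [norm_pow]
    exact pow_le_one₀ (norm_nonneg _) this.le
  · filter_upwards [hr] with z hz using hz.pow j

/-- Harmonic measures are mapped to harmonic measures by the boundary mapping. -/
theorem poissonExtension_comp (hf : IsInnerFunction f) (hT : Measurable T) (hT1 : ∀ z, ‖T z‖ = 1)
    (hr : ∀ᵐ z ∂circleMeasure, Tendsto (fun r : ℝ => f (r * z)) (𝓝[<] 1) (𝓝 (T z)))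
    {g : ℂ → ℂ} (hg : Measurable g) {w : ℂ} (hw : w ∈ Metric.ball (0 : ℂ) 1) :
    poissonExtension (fun z => g (T z)) w = poissonExtension g (f w) := by
  have hfw := hf.mapsTo hw
  refine integral_smul_comp_circleMeasure
    (M := max ((1 + ‖w‖) / (1 - ‖w‖)) ((1 + ‖f w‖) / (1 - ‖f w‖)))
    (measurable_poissonKernel w) (measurable_poissonKernel (f w))
    (fun z => poissonKernel_nonneg_of_norm_eq_one hw)
    (fun z => poissonKernel_nonneg_of_norm_eq_one hfw)
    (fun z hz => (norm_poissonKernel_le_of_norm_eq_one hw hz).trans (le_max_left _ _))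
    (fun z hz => (norm_poissonKernel_le_of_norm_eq_one hfw hz).trans (le_max_right _ _))
    hT hT1 (fun j => ?_) hg
  exact (poissonExtension_pow hf hr hw j).trans
    (poissonExtension_pow isInnerFunction_id (.of_forall tendsto_radial_id) hfw j).symm

/-- Iterating the transport of harmonic measure from `w` to `f w` avoids showing that `T^[n]` is the
radial limit of `f^[n]`. -/
theorem poissonExtension_iterate (hf : IsInnerFunction f) (hT : Measurable T)
    (hT1 : ∀ z, ‖T z‖ = 1)
    (hr : ∀ᵐ z ∂circleMeasure, Tendsto (fun r : ℝ => f (r * z)) (𝓝[<] 1) (𝓝 (T z)))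
    {w : ℂ} (hw : w ∈ Metric.ball (0 : ℂ) 1) (n : ℕ) :
    poissonExtension T^[n] w = f^[n] w := by
  induction n generalizing w with
  | zero =>
    have := poissonExtension_pow isInnerFunction_id (.of_forall tendsto_radial_id) hw 1
    simp only [pow_one] at this
    exact this
  | succ n ih =>
    rw [Function.iterate_succ, Function.iterate_succ_apply, ← ih (hf.mapsTo hw)]
    exact poissonExtension_comp hf hT hT1 hr (hT.iterate n) hw

theorem poissonExtension_zero_right (g : ℂ → ℂ) :
    poissonExtension g 0 = ∫ z, g z ∂circleMeasure := by
  refine integral_congr_ae ?_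
  filter_upwards [ae_norm_eq_one_circleMeasure] with z hz
  simp [poissonKernel_def, hz]

/-- Löwner's lemma. -/
theorem measurePreserving_of_tendsto_radial (hf : IsInnerFunction f) (hf0 : f 0 = 0)
    (hT : Measurable T) (hT1 : ∀ z, ‖T z‖ = 1)
    (hr : ∀ᵐ z ∂circleMeasure, Tendsto (fun r : ℝ => f (r * z)) (𝓝[<] 1) (𝓝 (T z))) :
    MeasurePreserving T circleMeasure circleMeasure := by
  refine ⟨hT, ?_⟩
  have h := map_withDensity_circleMeasure (h := 1) (k := 1) (M := 1) (T := T) measurable_one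
    measurable_one (by simp) (by simp) (by simp) (by simp) hT hT1 fun j => by
      have := poissonExtension_pow hf hr (w := 0) (by simp) j
      rw [poissonExtension_zero_right, hf0] at this
      have h1 := poissonExtension_pow isInnerFunction_id (.of_forall tendsto_radial_id)
        (w := 0) (by simp) j
      rw [poissonExtension_zero_right] at h1
      simpa using this.trans h1.symm
  simpa using h

/-- The integrand is the boundary function of `z * f z ^ j`, which vanishes at the origin. -/
theorem integral_mul_pow (hf : IsInnerFunction f)
    (hr : ∀ᵐ z ∂circleMeasure, Tendsto (fun r : ℝ => f (r * z)) (𝓝[<] 1) (𝓝 (T z))) (j : ℕ) :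
    ∫ z, z * T z ^ j ∂circleMeasure = 0 := by
  have := poissonExtension_eq_of_tendsto_radial (g := fun z => z * f z ^ j)
    (G := fun z => z * T z ^ j) (M := 1)
    (differentiableOn_id.mul (hf.differentiableOn.pow j)) (fun w hw => ?_) ?_
    (w := 0) (by simp)
  · simpa [poissonExtension_zero_right] using this
  · have h1 : ‖f w‖ < 1 := by simpa using hf.mapsTo hw
    have h2 : ‖w‖ < 1 := by simpa using hw
    rw [norm_mul, norm_pow]
    exact mul_le_one₀ h2.le (by positivity) (pow_le_one₀ (norm_nonneg _) h1.le)
  · filter_upwards [hr] with z hz using (tendsto_radial_id z).mul (hz.pow j)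

/-- Since `conj z = 1 / z` on the circle, the integrand is the boundary function of `(f z / z) * f z
^ j`, bounded by the Schwarz lemma. -/
theorem integral_conj_mul_pow_succ (hf : IsInnerFunction f) (hf0 : f 0 = 0)
    (hr : ∀ᵐ z ∂circleMeasure, Tendsto (fun r : ℝ => f (r * z)) (𝓝[<] 1) (𝓝 (T z))) (j : ℕ) :
    ∫ z, conj z * T z ^ (j + 1) ∂circleMeasure = deriv f 0 * 0 ^ j := by
  have hq {w : ℂ} (hw : w ∈ Metric.ball (0 : ℂ) 1) : ‖dslope f 0 w‖ ≤ 1 := by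
    simpa using Complex.norm_dslope_le_div_of_mapsTo_ball (R₂ := 1) hf.differentiableOn
      (fun z hz => Metric.ball_subset_closedBall (by simpa [hf0] using hf.mapsTo hz)) hw
  have := poissonExtension_eq_of_tendsto_radial (g := fun z => dslope f 0 z * f z ^ j)
    (G := fun z => conj z * T z ^ (j + 1)) (M := 1)
    (((Complex.differentiableOn_dslope (Metric.ball_mem_nhds _ one_pos)).2
      hf.differentiableOn).mul (hf.differentiableOn.pow j)) (fun w hw => ?_) ?_
    (w := 0) (by simp)
  · simpa [poissonExtension_zero_right, hf0] using this
  · have h1 : ‖f w‖ < 1 := by simpa using hf.mapsTo hw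
    rw [norm_mul, norm_pow]
    exact mul_le_one₀ (hq hw) (by positivity) (pow_le_one₀ (norm_nonneg _) h1.le)
  · filter_upwards [hr, ae_norm_eq_one_circleMeasure] with z hz h1
    have hz0 : z ≠ 0 := by rintro rfl; simp at h1
    have hlim : Tendsto (fun r : ℝ => ((r : ℂ) * z)⁻¹ * f (r * z)) (𝓝[<] 1) (𝓝 (z⁻¹ * T z)) :=
      ((tendsto_radial_id z).inv₀ hz0).mul hz
    have hzi : z⁻¹ = conj z := by
      rw [Complex.inv_def, Complex.normSq_eq_norm_sq, h1]; simp
    have := hlim.mul (hz.pow j)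
    rw [hzi, mul_assoc, ← pow_succ'] at this
    refine this.congr' ?_
    filter_upwards [Ioo_mem_nhdsLT one_pos] with r hr'
    have : (r * z : ℂ) ≠ 0 := mul_ne_zero (by exact_mod_cast hr'.1.ne') hz0
    rw [dslope_of_ne _ this, slope_def_field, hf0, sub_zero, sub_zero, div_eq_inv_mul]

theorem integral_conj_mul_pow (hf : IsInnerFunction f) (hf0 : f 0 = 0)
    (hr : ∀ᵐ z ∂circleMeasure, Tendsto (fun r : ℝ => f (r * z)) (𝓝[<] 1) (𝓝 (T z))) (j : ℕ) :
    ∫ z, conj z * T z ^ j ∂circleMeasure = if j = 1 then deriv f 0 else 0 := by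
  obtain _ | j := j
  · have := integral_mul_pow isInnerFunction_id (.of_forall tendsto_radial_id) 0
    have hc := integral_conj (μ := circleMeasure) (f := fun z : ℂ => z)
    simp only [pow_zero, mul_one] at this
    simpa [this] using hc
  · rw [integral_conj_mul_pow_succ hf hf0 hr]
    obtain rfl | hj := eq_or_ne j 0 <;> simp [*]

theorem integral_one_add_re_smul {c : ℂ} {g : ℂ → ℂ} {M : ℝ} (hg : Measurable g)
    (hM : ∀ z, ‖z‖ = 1 → ‖g z‖ ≤ M) :
    ∫ z, (1 + (c * z).re) • g z ∂circleMeasure = ∫ z, g z ∂circleMeasure +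
      (c / 2 * ∫ z, z * g z ∂circleMeasure + conj c / 2 * ∫ z, conj z * g z ∂circleMeasure) := by
  have h1 : Integrable g circleMeasure :=
    integrable_circleMeasure_of_norm_le hg.aestronglyMeasurable hM
  have h2 : Integrable (fun z => z * g z) circleMeasure :=
    integrable_circleMeasure_of_norm_le (measurable_id.mul hg).aestronglyMeasurable
      fun z hz => by simpa [hz] using hM z hz
  have h3 : Integrable (fun z => conj z * g z) circleMeasure :=
    integrable_circleMeasure_of_norm_le
      ((Complex.continuous_conj.measurable).mul hg).aestronglyMeasurable
      fun z hz => by simpa [hz] using hM z hz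
  have h4 : Integrable (fun z => c / 2 * (z * g z) + conj c / 2 * (conj z * g z)) circleMeasure :=
    (h2.const_mul _).add (h3.const_mul _)
  rw [← integral_const_mul, ← integral_const_mul, ← integral_add (h2.const_mul _) (h3.const_mul _),
    ← integral_add h1 h4]
  refine integral_congr_ae (.of_forall fun z => ?_)
  simp only [Complex.real_smul, Complex.ofReal_add, Complex.ofReal_one,
    Complex.re_eq_add_conj, map_mul]
  ring

/-- The result depends on `c` and `f` only through `conj c * deriv f 0`, so these are also the
moments of the identity with `c * conj (deriv f 0)` in place of `c`. -/
theorem integral_one_add_re_smul_pow (hf : IsInnerFunction f) (hf0 : f 0 = 0) (hT : Measurable T)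
    (hT1 : ∀ z, ‖z‖ = 1 → ‖T z‖ = 1)
    (hr : ∀ᵐ z ∂circleMeasure, Tendsto (fun r : ℝ => f (r * z)) (𝓝[<] 1) (𝓝 (T z)))
    (c : ℂ) (j : ℕ) :
    ∫ z, (1 + (c * z).re) • T z ^ j ∂circleMeasure =
      0 ^ j + if j = 1 then conj c / 2 * deriv f 0 else 0 := by
  rw [integral_one_add_re_smul (M := 1) (hT.pow_const j) (fun z hz => by simp [hT1 z hz]),
    integral_mul_pow hf hr, integral_conj_mul_pow hf hf0 hr, ← poissonExtension_zero_right,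
    poissonExtension_pow hf hr (by simp), hf0]
  simp

/-- The conditional expectation of the identity given the boundary mapping `T` of an inner function
`f` fixing the origin is `conj (f'(0)) T`. -/
theorem integral_mul_comp (hf : IsInnerFunction f) (hf0 : f 0 = 0) (hl : ‖deriv f 0‖ ≤ 1)
    (hT : Measurable T) (hT1 : ∀ z, ‖T z‖ = 1)
    (hr : ∀ᵐ z ∂circleMeasure, Tendsto (fun r : ℝ => f (r * z)) (𝓝[<] 1) (𝓝 (T z)))
    {g : ℂ → ℂ} {M : ℝ} (hg : Measurable g) (hM : ∀ z, ‖z‖ = 1 → ‖g z‖ ≤ M) :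
    ∫ z, z * g (T z) ∂circleMeasure = conj (deriv f 0) * ∫ z, z * g z ∂circleMeasure := by
  have hpos {c z : ℂ} (hc : ‖c‖ ≤ 1) (hz : ‖z‖ = 1) : |(c * z).re| ≤ 1 :=
    (Complex.abs_re_le_norm _).trans (by simpa [hz] using hc)
  -- The densities `1 + Re (c z)` are nonnegative, so moment determinacy applies: `T` carries each
  -- to the density of the same form with parameter `c * conj (deriv f 0)`.
  have key {c : ℂ} (hc : ‖c‖ = 1) :
      ∫ z, (1 + (c * z).re) • g (T z) ∂circleMeasure =
        ∫ z, (1 + (c * conj (deriv f 0) * z).re) • g z ∂circleMeasure := by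
    have hc' : ‖c * conj (deriv f 0)‖ ≤ 1 := by simpa [hc] using hl
    refine integral_smul_comp_circleMeasure (M := 2) (by fun_prop) (by fun_prop)
      (fun z hz => by linarith [(abs_le.1 (hpos hc.le hz)).1])
      (fun z hz => by linarith [(abs_le.1 (hpos hc' hz)).1])
      (fun z hz => ?_) (fun z hz => ?_) hT hT1 (fun j => ?_) hg
    · exact (norm_add_le _ _).trans (by
        rw [norm_one, Real.norm_eq_abs]; linarith [hpos hc.le hz])
    · exact (norm_add_le _ _).trans (by
        rw [norm_one, Real.norm_eq_abs]; linarith [hpos hc' hz])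
    · rw [integral_one_add_re_smul_pow hf hf0 hT (fun z _ => hT1 z) hr]
      have := integral_one_add_re_smul_pow (T := id) isInnerFunction_id rfl measurable_id
        (fun z hz => hz) (.of_forall tendsto_radial_id) (c * conj (deriv f 0)) j
      simp only [id_eq] at this
      rw [this]
      simp [deriv_id', mul_div_right_comm]
  have hgT : ∫ z, g (T z) ∂circleMeasure = ∫ z, g z ∂circleMeasure := by
    have hp := measurePreserving_of_tendsto_radial hf hf0 hT hT1 hr
    conv_rhs => rw [← hp.map_eq, integral_map hT.aemeasurable hg.aestronglyMeasurable]
  have e1 := key (c := 1) (by simp)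
  have e2 := key (c := Complex.I) (by simp)
  have hgTm : Measurable fun z => g (T z) := hg.comp hT
  rw [integral_one_add_re_smul hgTm (fun z _ => hM _ (hT1 z)),
    integral_one_add_re_smul hg hM, hgT] at e1 e2
  simp only [map_one, Complex.conj_I, map_mul, Complex.conj_conj] at e1 e2
  -- Combining `c = 1` and `c = I` cancels the integrals against `conj z`.
  linear_combination e1 - Complex.I * e2 + (1 / 2 * ((∫ z, z * g (T z) ∂circleMeasure)
    - (∫ z, conj z * g (T z) ∂circleMeasure)
    - conj (deriv f 0) * (∫ z, z * g z ∂circleMeasure)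
    + deriv f 0 * (∫ z, conj z * g z ∂circleMeasure))) * Complex.I_sq

/-- Schwarz lemma: equality would force `f` to be a rotation. -/
theorem norm_deriv_zero_lt_one (hf : IsInnerFunction f) (hf0 : f 0 = 0) (hrot : ¬ IsRotation f) :
    ‖deriv f 0‖ < 1 := by
  have hmaps : Set.MapsTo f (Metric.ball 0 1) (Metric.closedBall (f 0) 1) := fun z hz =>
    Metric.ball_subset_closedBall (by simpa [hf0] using hf.mapsTo hz)
  refine lt_of_le_of_ne ?_ fun h => hrot ⟨deriv f 0, h, fun w hw => ?_⟩
  · simpa using Complex.norm_dslope_le_div_of_mapsTo_ball (z := 0) hf.differentiableOn hmaps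
      (by simp)
  · have := Complex.affine_of_mapsTo_ball_of_norm_dslope_eq_div (z₀ := 0) hf.differentiableOn hmaps
      (by simp) (by simpa using h) hw
    simpa [hf0, mul_comm] using this

end RadialLimit

/-! ### Bounded Borel functions, and a pointwise fourth power inequality -/

/-- Borel functions that are bounded on the unit circle. -/
def IsCircleBounded (g : ℂ → ℂ) : Prop :=
  Measurable g ∧ ∃ M, ∀ z, ‖z‖ = 1 → ‖g z‖ ≤ M

namespace IsCircleBounded

variable {g h : ℂ → ℂ}

theorem integrable (hg : IsCircleBounded g) : Integrable g circleMeasure :=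
  integrable_circleMeasure_of_norm_le hg.1.aestronglyMeasurable hg.2.choose_spec

theorem integrable_norm_pow (hg : IsCircleBounded g) (n : ℕ) :
    Integrable (fun z => ‖g z‖ ^ n) circleMeasure := by
  obtain ⟨hm, M, hM⟩ := hg
  refine integrable_circleMeasure_of_norm_le (M := M ^ n) (hm.norm.pow_const n).aestronglyMeasurable
    fun z hz => ?_
  rw [norm_pow, norm_norm]
  exact pow_le_pow_left₀ (norm_nonneg _) (hM z hz) n

theorem memLp (hg : IsCircleBounded g) (p : ℝ≥0∞) : MemLp g p circleMeasure := by
  obtain ⟨hm, M, hM⟩ := hg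
  refine MemLp.of_bound hm.aestronglyMeasurable M ?_
  filter_upwards [ae_norm_eq_one_circleMeasure] with z hz using hM z hz

theorem const (c : ℂ) : IsCircleBounded fun _ => c := ⟨measurable_const, ‖c‖, fun _ _ => le_rfl⟩

theorem id' : IsCircleBounded fun z => z := ⟨measurable_id, 1, fun _ hz => hz.le⟩

theorem add (hg : IsCircleBounded g) (hh : IsCircleBounded h) :
    IsCircleBounded fun z => g z + h z := by
  obtain ⟨hm, M, hM⟩ := hg
  obtain ⟨hm', M', hM'⟩ := hh
  exact ⟨hm.add hm', M + M', fun z hz => norm_add_le_of_le (hM z hz) (hM' z hz)⟩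

theorem sub (hg : IsCircleBounded g) (hh : IsCircleBounded h) :
    IsCircleBounded fun z => g z - h z := by
  obtain ⟨hm, M, hM⟩ := hg
  obtain ⟨hm', M', hM'⟩ := hh
  exact ⟨hm.sub hm', M + M', fun z hz => norm_sub_le_of_le (hM z hz) (hM' z hz)⟩

theorem mul (hg : IsCircleBounded g) (hh : IsCircleBounded h) :
    IsCircleBounded fun z => g z * h z := by
  obtain ⟨hm, M, hM⟩ := hg
  obtain ⟨hm', M', hM'⟩ := hh
  refine ⟨hm.mul hm', M * M', fun z hz => ?_⟩
  rw [norm_mul]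
  exact mul_le_mul (hM z hz) (hM' z hz) (norm_nonneg _) ((norm_nonneg _).trans (hM z hz))

theorem conjugate (hg : IsCircleBounded g) : IsCircleBounded fun z => (starRingEnd ℂ) (g z) := by
  obtain ⟨hm, M, hM⟩ := hg
  exact ⟨Complex.continuous_conj.measurable.comp hm, M, fun z hz => by simpa using hM z hz⟩

theorem norm_sq (hg : IsCircleBounded g) : IsCircleBounded fun z => ((‖g z‖ ^ 2 : ℝ) : ℂ) := by
  convert hg.mul hg.conjugate using 2 with z
  rw [Complex.mul_conj, Complex.normSq_eq_norm_sq]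

theorem sum {ι : Type*} {s : Finset ι} {g : ι → ℂ → ℂ} (hg : ∀ i ∈ s, IsCircleBounded (g i)) :
    IsCircleBounded fun z => ∑ i ∈ s, g i z := by
  classical
  induction s using Finset.induction_on with
  | empty => simpa using const 0
  | insert i s hi ih =>
    simp only [Finset.sum_insert hi]
    exact (hg i (by simp)).add (ih fun j hj => hg j (by simp [hj]))

end IsCircleBounded

/-- Measure preserving Borel maps `T` of the circle such that the conditional expectation of the
identity given `T` is `conj l * T`. -/
structure IsInnerBoundaryMap (T : ℂ → ℂ) (l : ℂ) : Prop where
  norm_eq_one : ∀ z, ‖T z‖ = 1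
  measurePreserving : MeasurePreserving T circleMeasure circleMeasure
  integral_mul_comp : ∀ g, IsCircleBounded g →
    ∫ z, z * g (T z) ∂circleMeasure = conj l * ∫ z, z * g z ∂circleMeasure
  integral_mul_self : ∫ z, z * z ∂circleMeasure = 0

theorem integrable_re_circleMeasure {g : ℂ → ℂ} (hg : Integrable g circleMeasure) :
    Integrable (fun z => (g z).re) circleMeasure :=
  hg.re

theorem integral_re_circleMeasure {g : ℂ → ℂ} (hg : Integrable g circleMeasure) :
    ∫ z, (g z).re ∂circleMeasure = (∫ z, g z ∂circleMeasure).re :=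
  integral_re hg

theorem Complex.norm_add_sq (x y : ℂ) :
    ‖x + y‖ ^ 2 = ‖x‖ ^ 2 + ‖y‖ ^ 2 + 2 * (x * conj y).re := by
  rw [← Complex.normSq_eq_norm_sq, ← Complex.normSq_eq_norm_sq, ← Complex.normSq_eq_norm_sq,
    Complex.normSq_add]

/-- Square `|s|² + |d|² + 2p` with `p = Re (d * conj s)`, keep `4 p |s|²`, and use `p² ≤ |d|² |s|²`
and `2 |s| |d|³ ≤ |s|² |d|² + |d|⁴`: the constants are `2 + 4 + 2 = 8` and `1 + 2 = 3`. -/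
theorem Complex.norm_add_pow_four_le (s d : ℂ) :
    ‖d + s‖ ^ 4 ≤ ‖s‖ ^ 4 + 4 * (d * (conj s * (‖s‖ ^ 2 : ℝ))).re
      + (8 * ‖s‖ ^ 2 * ‖d‖ ^ 2 + 3 * ‖d‖ ^ 4) := by
  have h1 := Complex.norm_add_sq d s
  have h2 : (d * (conj s * (‖s‖ ^ 2 : ℝ))).re = (d * conj s).re * ‖s‖ ^ 2 := by
    rw [← mul_assoc, Complex.re_mul_ofReal]
  have h3 : |(d * conj s).re| ≤ ‖d‖ * ‖s‖ := (Complex.abs_re_le_norm _).trans (by simp)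
  have h4 : ‖d + s‖ ^ 4 = (‖d + s‖ ^ 2) ^ 2 := by ring
  rw [h2, h4, h1]
  set p := (d * conj s).re
  have h5 : p ^ 2 ≤ (‖d‖ * ‖s‖) ^ 2 := sq_le_sq' (abs_le.1 h3).1 (abs_le.1 h3).2
  have h6 : p * ‖d‖ ^ 2 ≤ ‖d‖ * ‖s‖ * ‖d‖ ^ 2 :=
    mul_le_mul_of_nonneg_right (abs_le.1 h3).2 (by positivity)
  nlinarith [mul_nonneg (sq_nonneg ‖d‖) (sq_nonneg (‖s‖ - ‖d‖))]

/-! ### Correlations of iterates and one martingale step -/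

namespace IsInnerBoundaryMap

variable {T : ℂ → ℂ} {l : ℂ}

theorem measurable (hT : IsInnerBoundaryMap T l) : Measurable T := hT.measurePreserving.measurable

theorem comp (hT : IsInnerBoundaryMap T l) {g : ℂ → ℂ} (hg : IsCircleBounded g) :
    IsCircleBounded fun z => g (T z) :=
  ⟨hg.1.comp hT.measurable, hg.2.choose, fun z _ => hg.2.choose_spec _ (hT.norm_eq_one z)⟩

theorem isCircleBounded (hT : IsInnerBoundaryMap T l) : IsCircleBounded T :=
  hT.comp IsCircleBounded.id'

theorem isCircleBounded_iterate (hT : IsInnerBoundaryMap T l) (n : ℕ) :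
    IsCircleBounded T^[n] := by
  induction n with
  | zero => exact IsCircleBounded.id'
  | succ n ih => exact hT.comp ih

theorem integral_comp {E : Type*} [NormedAddCommGroup E] [NormedSpace ℝ E]
    (hT : IsInnerBoundaryMap T l) {g : ℂ → E} (hg : AEStronglyMeasurable g circleMeasure) :
    ∫ z, g (T z) ∂circleMeasure = ∫ z, g z ∂circleMeasure := by
  have hp := hT.measurePreserving
  conv_rhs => rw [← hp.map_eq, integral_map hp.measurable.aemeasurable (hp.map_eq.symm ▸ hg)]

theorem integral_comp_iterate {E : Type*} [NormedAddCommGroup E] [NormedSpace ℝ E]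
    (hT : IsInnerBoundaryMap T l) {g : ℂ → E} (hg : AEStronglyMeasurable g circleMeasure) (n : ℕ) :
    ∫ z, g (T^[n] z) ∂circleMeasure = ∫ z, g z ∂circleMeasure := by
  have hp := hT.measurePreserving.iterate n
  conv_rhs => rw [← hp.map_eq, integral_map hp.measurable.aemeasurable (hp.map_eq.symm ▸ hg)]

theorem integral_id_mul_conj_self : ∫ z : ℂ, z * conj z ∂circleMeasure = 1 := by
  have : ∫ z : ℂ, z * conj z ∂circleMeasure = ∫ _ : ℂ, (1 : ℂ) ∂circleMeasure := by
    refine integral_congr_ae ?_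
    filter_upwards [ae_norm_eq_one_circleMeasure] with z hz
    rw [Complex.mul_conj, Complex.normSq_eq_norm_sq, hz]; simp
  simpa using this

/-- Invariance removes `T^[n]`; then each use of the conditional expectation removes one `T` at the
cost of a factor `conj l`. -/
theorem integral_mul_conj_iterate (hT : IsInnerBoundaryMap T l) (n k : ℕ) :
    ∫ z, T^[n] z * conj (T^[n + k] z) ∂circleMeasure = conj l ^ k := by
  have h0 : ∫ z, z * conj (T^[k] z) ∂circleMeasure = conj l ^ k := by
    induction k with
    | zero => simpa using integral_id_mul_conj_self
    | succ k ih =>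
      rw [pow_succ', ← ih]
      exact hT.integral_mul_comp _ (hT.isCircleBounded_iterate k).conjugate
  rw [← h0, ← hT.integral_comp_iterate
    (IsCircleBounded.id'.mul (hT.isCircleBounded_iterate k).conjugate).1.aestronglyMeasurable n]
  simp only [add_comm n k, Function.iterate_add_apply]

/-- The same reduction, ending at `∫ z² = 0`. -/
theorem integral_mul_iterate (hT : IsInnerBoundaryMap T l) (n k : ℕ) :
    ∫ z, T^[n] z * T^[n + k] z ∂circleMeasure = 0 := by
  have h0 : ∫ z, z * T^[k] z ∂circleMeasure = 0 := by
    induction k with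
    | zero => simpa using hT.integral_mul_self
    | succ k ih =>
      have := hT.integral_mul_comp _ (hT.isCircleBounded_iterate k)
      rw [ih, mul_zero] at this
      exact this
  rw [← h0, ← hT.integral_comp_iterate
    (IsCircleBounded.id'.mul (hT.isCircleBounded_iterate k)).1.aestronglyMeasurable n]
  simp only [add_comm n k, Function.iterate_add_apply]

/-- The martingale difference property, on which all orthogonality below rests. -/
theorem integral_difference_mul_comp (hT : IsInnerBoundaryMap T l) {g : ℂ → ℂ}
    (hg : IsCircleBounded g) : ∫ z, (z - conj l * T z) * g (T z) ∂circleMeasure = 0 := by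
  have h1 := (IsCircleBounded.id'.mul (hT.comp hg)).integrable
  have h2 := ((hT.isCircleBounded.mul (hT.comp hg)).integrable).const_mul (conj l)
  have : ∫ z, (z - conj l * T z) * g (T z) ∂circleMeasure =
      ∫ z, z * g (T z) - conj l * (T z * g (T z)) ∂circleMeasure := by
    congr 1; ext z; ring
  rw [this, integral_sub h1 h2, hT.integral_mul_comp g hg, integral_const_mul,
    hT.integral_comp (g := fun z => z * g z) (IsCircleBounded.id'.mul hg).1.aestronglyMeasurable,
    sub_self]

theorem isCircleBounded_difference (hT : IsInnerBoundaryMap T l) :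
    IsCircleBounded fun z => z - conj l * T z :=
  IsCircleBounded.id'.sub ((IsCircleBounded.const _).mul hT.isCircleBounded)

theorem integral_norm_sq_difference (hT : IsInnerBoundaryMap T l) :
    ∫ z, ‖z - conj l * T z‖ ^ 2 ∂circleMeasure = 1 - ‖l‖ ^ 2 := by
  have h0 : ∫ z, z * conj (T z) ∂circleMeasure = conj l := by
    simpa using hT.integral_mul_conj_iterate 0 1
  have h1 : Integrable (fun z => -l * (z * conj (T z))) circleMeasure :=
    ((IsCircleBounded.const _).mul (IsCircleBounded.id'.mul hT.isCircleBounded.conjugate)).integrable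
  have h1re := integrable_re_circleMeasure h1
  have : ∫ z, ‖z - conj l * T z‖ ^ 2 ∂circleMeasure =
      ∫ z, (1 + ‖l‖ ^ 2) + 2 * (-l * (z * conj (T z))).re ∂circleMeasure := by
    refine integral_congr_ae ?_
    filter_upwards [ae_norm_eq_one_circleMeasure] with z hz
    rw [sub_eq_add_neg, Complex.norm_add_sq, hz, norm_neg, norm_mul, hT.norm_eq_one]
    simp only [map_neg, map_mul, Complex.conj_conj, RCLike.norm_conj]
    ring_nf
  rw [this, integral_add (integrable_const _) (h1re.const_mul 2), integral_const_mul,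
    integral_re_circleMeasure h1, integral_const_mul, h0]
  have : -l * conj l = ((-‖l‖ ^ 2 : ℝ) : ℂ) := by
    rw [neg_mul, Complex.mul_conj, Complex.normSq_eq_norm_sq]; push_cast; ring
  rw [this, Complex.ofReal_re]
  simp
  ring

theorem integral_norm_sq_step (hT : IsInnerBoundaryMap T l) (c : ℂ) {g : ℂ → ℂ}
    (hg : IsCircleBounded g) :
    ∫ z, ‖c * (z - conj l * T z) + g (T z)‖ ^ 2 ∂circleMeasure =
      ‖c‖ ^ 2 * (1 - ‖l‖ ^ 2) + ∫ z, ‖g z‖ ^ 2 ∂circleMeasure := by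
  have hD := hT.isCircleBounded_difference
  have h1 : Integrable (fun z => c * ((z - conj l * T z) * conj (g (T z)))) circleMeasure :=
    ((IsCircleBounded.const _).mul (hD.mul (hT.comp hg.conjugate))).integrable
  have h1re := integrable_re_circleMeasure h1
  have h2 := (hD.integrable_norm_pow 2).const_mul (‖c‖ ^ 2)
  have h3 := (hT.comp hg).integrable_norm_pow 2
  have h23 : Integrable (fun z => ‖c‖ ^ 2 * ‖z - conj l * T z‖ ^ 2 + ‖g (T z)‖ ^ 2)
    circleMeasure := h2.add h3
  have : ∫ z, ‖c * (z - conj l * T z) + g (T z)‖ ^ 2 ∂circleMeasure =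
      ∫ z, (‖c‖ ^ 2 * ‖z - conj l * T z‖ ^ 2 + ‖g (T z)‖ ^ 2) +
        2 * (c * ((z - conj l * T z) * conj (g (T z)))).re ∂circleMeasure := by
    congr 1; ext z
    rw [Complex.norm_add_sq, norm_mul, mul_pow, mul_assoc c]
  rw [this, integral_add h23 (h1re.const_mul 2), integral_add h2 h3, integral_const_mul,
    integral_const_mul, integral_re_circleMeasure h1, integral_const_mul,
    hT.integral_difference_mul_comp hg.conjugate, hT.integral_norm_sq_difference,
    hT.integral_comp (g := fun z => ‖g z‖ ^ 2) (hg.integrable_norm_pow 2).1]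
  simp

/-- The term linear in the difference is multiplied by `conj g * |g|²` evaluated at `T z`, a
function of `T z`, so its integral vanishes. -/
theorem integral_norm_pow_four_step (hT : IsInnerBoundaryMap T l) (hl : ‖l‖ ≤ 1) (c : ℂ)
    {g : ℂ → ℂ} (hg : IsCircleBounded g) :
    ∫ z, ‖c * (z - conj l * T z) + g (T z)‖ ^ 4 ∂circleMeasure ≤
      ∫ z, ‖g z‖ ^ 4 ∂circleMeasure + 32 * ‖c‖ ^ 2 * ∫ z, ‖g z‖ ^ 2 ∂circleMeasure
        + 48 * ‖c‖ ^ 4 := by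
  have hD := hT.isCircleBounded_difference
  have hS : IsCircleBounded fun z => conj (g z) * (‖g z‖ ^ 2 : ℝ) := hg.conjugate.mul hg.norm_sq
  have h1 : Integrable (fun z => c * ((z - conj l * T z) * (conj (g (T z)) * (‖g (T z)‖ ^ 2 : ℝ))))
    circleMeasure := ((IsCircleBounded.const _).mul (hD.mul (hT.comp hS))).integrable
  have h1re := integrable_re_circleMeasure h1
  have h2 := (hT.comp hg).integrable_norm_pow 2
  have h4 := (hT.comp hg).integrable_norm_pow 4
  have h6 := (((IsCircleBounded.const c).mul hD).add (hT.comp hg)).integrable_norm_pow 4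
  have h42 : Integrable (fun z => ‖g (T z)‖ ^ 4 + 32 * ‖c‖ ^ 2 * ‖g (T z)‖ ^ 2)
    circleMeasure := h4.add (h2.const_mul _)
  have h5 : Integrable (fun z => ‖g (T z)‖ ^ 4 + 32 * ‖c‖ ^ 2 * ‖g (T z)‖ ^ 2 + 48 * ‖c‖ ^ 4)
    circleMeasure := h42.add (integrable_const _)
  have hle : ∫ z, ‖c * (z - conj l * T z) + g (T z)‖ ^ 4 ∂circleMeasure ≤
      ∫ z, (‖g (T z)‖ ^ 4 + 32 * ‖c‖ ^ 2 * ‖g (T z)‖ ^ 2 + 48 * ‖c‖ ^ 4) + 4 *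
        (c * ((z - conj l * T z) * (conj (g (T z)) * (‖g (T z)‖ ^ 2 : ℝ)))).re ∂circleMeasure := by
    refine integral_mono_ae h6 (h5.add (h1re.const_mul 4)) ?_
    filter_upwards [ae_norm_eq_one_circleMeasure] with z hz
    -- This bound turns the pointwise constants into `8 * 2² = 32` and `3 * 2⁴ = 48`.
    have hd : ‖c * (z - conj l * T z)‖ ≤ 2 * ‖c‖ := by
      have : ‖z - conj l * T z‖ ≤ 2 := by
        refine (norm_sub_le _ _).trans ?_
        rw [hz, norm_mul, hT.norm_eq_one, RCLike.norm_conj]; linarith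
      rw [norm_mul, mul_comm]
      exact mul_le_mul_of_nonneg_right this (norm_nonneg _)
    have hd2 := pow_le_pow_left₀ (norm_nonneg _) hd 2
    have hd4 := pow_le_pow_left₀ (norm_nonneg _) hd 4
    have := Complex.norm_add_pow_four_le (g (T z)) (c * (z - conj l * T z))
    rw [mul_assoc c (z - conj l * T z)] at this
    nlinarith [mul_le_mul_of_nonneg_left hd2 (sq_nonneg ‖g (T z)‖)]
  rw [integral_add h5 (h1re.const_mul 4), integral_const_mul, integral_re_circleMeasure h1,
    integral_const_mul, hT.integral_difference_mul_comp hS,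
    integral_add h42 (integrable_const _), integral_add h4 (h2.const_mul _),
    integral_const_mul, hT.integral_comp (g := fun z => ‖g z‖ ^ 2) (hg.integrable_norm_pow 2).1,
    hT.integral_comp (g := fun z => ‖g z‖ ^ 4) (hg.integrable_norm_pow 4).1] at hle
  simpa using hle

end IsInnerBoundaryMap

/-! ### Moments of reversed martingales -/

/-- The sum `∑_{n < N} c_n (T^n - κ T^{n+1}) + c_N T^N` of reversed martingale differences. -/
noncomputable def reversedMartingale (T : ℂ → ℂ) (κ : ℂ) : ℕ → (ℕ → ℂ) → ℂ → ℂ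
  | 0, c, z => c 0 * z
  | N + 1, c, z => c 0 * (z - κ * T z) + reversedMartingale T κ N (fun n => c (n + 1)) (T z)

theorem reversedMartingale_eq_sum (T : ℂ → ℂ) (κ : ℂ) (N : ℕ) (c : ℕ → ℂ) (z : ℂ) :
    reversedMartingale T κ N c z =
      c 0 * z + ∑ n ∈ Finset.range N, (c (n + 1) - κ * c n) * T^[n + 1] z := by
  induction N generalizing c z with
  | zero => simp [reversedMartingale]
  | succ N ih =>
    rw [reversedMartingale, ih, Finset.sum_range_succ']
    simp only [Function.iterate_succ_apply, Function.iterate_zero_apply]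
    ring

namespace IsInnerBoundaryMap

variable {T : ℂ → ℂ} {l : ℂ}

theorem isCircleBounded_reversedMartingale (hT : IsInnerBoundaryMap T l) (N : ℕ) (c : ℕ → ℂ) :
    IsCircleBounded (reversedMartingale T (conj l) N c) := by
  induction N generalizing c with
  | zero => exact (IsCircleBounded.const _).mul IsCircleBounded.id'
  | succ N ih =>
    exact ((IsCircleBounded.const _).mul hT.isCircleBounded_difference).add (hT.comp (ih _))

theorem integral_norm_sq_reversedMartingale (hT : IsInnerBoundaryMap T l) (N : ℕ) (c : ℕ → ℂ) :
    ∫ z, ‖reversedMartingale T (conj l) N c z‖ ^ 2 ∂circleMeasure =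
      (1 - ‖l‖ ^ 2) * ∑ n ∈ Finset.range N, ‖c n‖ ^ 2 + ‖c N‖ ^ 2 := by
  induction N generalizing c with
  | zero =>
    have : ∫ z : ℂ, ‖c 0 * z‖ ^ 2 ∂circleMeasure = ∫ z : ℂ, ‖c 0‖ ^ 2 ∂circleMeasure := by
      refine integral_congr_ae ?_
      filter_upwards [ae_norm_eq_one_circleMeasure] with z hz
      rw [norm_mul, hz, mul_one]
    simpa [reversedMartingale] using this
  | succ N ih =>
    simp only [reversedMartingale]
    rw [hT.integral_norm_sq_step _ (hT.isCircleBounded_reversedMartingale _ _), ih,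
      Finset.sum_range_succ']
    ring

theorem integral_norm_sq_reversedMartingale_le (hT : IsInnerBoundaryMap T l) (N : ℕ)
    (c : ℕ → ℂ) :
    ∫ z, ‖reversedMartingale T (conj l) N c z‖ ^ 2 ∂circleMeasure ≤
      ∑ n ∈ Finset.range (N + 1), ‖c n‖ ^ 2 := by
  rw [hT.integral_norm_sq_reversedMartingale, Finset.sum_range_succ]
  have : 0 ≤ ∑ n ∈ Finset.range N, ‖c n‖ ^ 2 := Finset.sum_nonneg fun _ _ => by positivity
  nlinarith [mul_nonneg (sq_nonneg ‖l‖) this]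

theorem le_integral_norm_sq_reversedMartingale (hT : IsInnerBoundaryMap T l) (N : ℕ)
    (c : ℕ → ℂ) :
    (1 - ‖l‖ ^ 2) * ∑ n ∈ Finset.range (N + 1), ‖c n‖ ^ 2 ≤
      ∫ z, ‖reversedMartingale T (conj l) N c z‖ ^ 2 ∂circleMeasure := by
  rw [hT.integral_norm_sq_reversedMartingale, Finset.sum_range_succ]
  nlinarith [mul_nonneg (sq_nonneg ‖l‖) (sq_nonneg ‖c N‖)]

/-- With `x = |c 0|²` and `R` the sum of the other squares, the induction closes because `48 R² + 32
x R + 48 x² ≤ 48 (x + R)²`. -/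
theorem integral_norm_pow_four_reversedMartingale_le (hT : IsInnerBoundaryMap T l) (hl : ‖l‖ ≤ 1)
    (N : ℕ) (c : ℕ → ℂ) :
    ∫ z, ‖reversedMartingale T (conj l) N c z‖ ^ 4 ∂circleMeasure ≤
      48 * (∑ n ∈ Finset.range (N + 1), ‖c n‖ ^ 2) ^ 2 := by
  induction N generalizing c with
  | zero =>
    have : ∫ z : ℂ, ‖c 0 * z‖ ^ 4 ∂circleMeasure = ∫ z : ℂ, ‖c 0‖ ^ 4 ∂circleMeasure := by
      refine integral_congr_ae ?_
      filter_upwards [ae_norm_eq_one_circleMeasure] with z hz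
      rw [norm_mul, hz, mul_one]
    simp only [reversedMartingale, this, zero_add, Finset.range_one, Finset.sum_singleton]
    simp only [integral_const, probReal_univ, one_smul]
    nlinarith [sq_nonneg (‖c 0‖ ^ 2)]
  | succ N ih =>
    have h2 := hT.integral_norm_sq_reversedMartingale_le N fun n => c (n + 1)
    have h4 := ih fun n => c (n + 1)
    have := hT.integral_norm_pow_four_step hl (c 0)
      (hT.isCircleBounded_reversedMartingale N fun n => c (n + 1))
    rw [Finset.sum_range_succ']
    simp only [reversedMartingale]
    refine this.trans ?_
    have h3 := mul_le_mul_of_nonneg_left h2 (sq_nonneg ‖c 0‖)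
    have h0 : 0 ≤ ‖c 0‖ ^ 2 * ∑ n ∈ Finset.range (N + 1), ‖c (n + 1)‖ ^ 2 := by positivity
    nlinarith

end IsInnerBoundaryMap

/-! ### Comparing the coefficients `b` with the filtered coefficients -/

/-- The solution of `c_0 = b_0`, `c_{n+1} - κ c_n = b_{n+1}`. -/
noncomputable def geometricFilter (κ : ℂ) (b : ℕ → ℂ) : ℕ → ℂ
  | 0 => b 0
  | n + 1 => b (n + 1) + κ * geometricFilter κ b n

/-- Cauchy–Schwarz with weights `1` and `r`. -/
theorem add_mul_sq_le {r x y : ℝ} (hr : 0 ≤ r) :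
    (x + r * y) ^ 2 ≤ (1 + r) * (x ^ 2 + r * y ^ 2) := by
  nlinarith [mul_nonneg hr (sq_nonneg (x - y))]

theorem sum_norm_sq_le_geometricFilter (κ : ℂ) (b : ℕ → ℂ) (N : ℕ) :
    ∑ n ∈ Finset.range (N + 1), ‖b n‖ ^ 2 ≤
      (1 + ‖κ‖) ^ 2 * ∑ n ∈ Finset.range (N + 1), ‖geometricFilter κ b n‖ ^ 2 := by
  have h : ∑ n ∈ Finset.range (N + 1), ‖b n‖ ^ 2 ≤
      (1 + ‖κ‖) * (∑ n ∈ Finset.range (N + 1), ‖geometricFilter κ b n‖ ^ 2 +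
        ‖κ‖ * ∑ n ∈ Finset.range N, ‖geometricFilter κ b n‖ ^ 2) := by
    induction N with
    | zero =>
      simp only [zero_add, Finset.range_one, Finset.sum_singleton, geometricFilter,
        Finset.range_zero, Finset.sum_empty]
      nlinarith [mul_nonneg (norm_nonneg κ) (sq_nonneg ‖b 0‖)]
    | succ N ih =>
      rw [Finset.sum_range_succ, Finset.sum_range_succ _ (N + 1),
        Finset.sum_range_succ (fun n => ‖geometricFilter κ b n‖ ^ 2) N]
      have h1 : ‖b (N + 1)‖ ≤ ‖geometricFilter κ b (N + 1)‖ + ‖κ‖ * ‖geometricFilter κ b N‖ := by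
        have : b (N + 1) = geometricFilter κ b (N + 1) - κ * geometricFilter κ b N := by
          simp [geometricFilter]
        rw [this, ← norm_mul]
        exact norm_sub_le _ _
      have h2 := (pow_le_pow_left₀ (norm_nonneg _) h1 2).trans (add_mul_sq_le (norm_nonneg κ))
      rw [Finset.sum_range_succ (fun n => ‖geometricFilter κ b n‖ ^ 2) N] at ih
      linarith
  refine h.trans ?_
  rw [Finset.sum_range_succ _ N]
  have : 0 ≤ (1 + ‖κ‖) * ‖κ‖ * ‖geometricFilter κ b N‖ ^ 2 := by positivity
  nlinarith

theorem geometricFilter_sum_norm_sq_le {κ : ℂ} (hκ : ‖κ‖ ≤ 1) (b : ℕ → ℂ) (N : ℕ) :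
    (1 - ‖κ‖) ^ 2 * ∑ n ∈ Finset.range (N + 1), ‖geometricFilter κ b n‖ ^ 2 ≤
      ∑ n ∈ Finset.range (N + 1), ‖b n‖ ^ 2 := by
  have hκ' : 0 ≤ 1 - ‖κ‖ := by linarith
  -- Convexity of the square, with weights `1 - ‖κ‖` and `‖κ‖`, summed over the recursion. Absorbing
  -- the last sum on the left gives the second factor `1 - ‖κ‖`.
  have h : (1 - ‖κ‖) * ∑ n ∈ Finset.range (N + 1), ‖geometricFilter κ b n‖ ^ 2 ≤
      ∑ n ∈ Finset.range (N + 1), ‖b n‖ ^ 2 +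
        ‖κ‖ * (1 - ‖κ‖) * ∑ n ∈ Finset.range N, ‖geometricFilter κ b n‖ ^ 2 := by
    induction N with
    | zero =>
      simp only [zero_add, Finset.range_one, Finset.sum_singleton, geometricFilter,
        Finset.range_zero, Finset.sum_empty]
      nlinarith [mul_nonneg (norm_nonneg κ) (sq_nonneg ‖b 0‖)]
    | succ N ih =>
      rw [Finset.sum_range_succ, Finset.sum_range_succ _ (N + 1),
        Finset.sum_range_succ (fun n => ‖geometricFilter κ b n‖ ^ 2) N]
      have h1 : ‖geometricFilter κ b (N + 1)‖ ≤ ‖b (N + 1)‖ + ‖κ‖ * ‖geometricFilter κ b N‖ := by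
        rw [geometricFilter, ← norm_mul]
        exact norm_add_le _ _
      have h2 : (1 - ‖κ‖) * ‖geometricFilter κ b (N + 1)‖ ^ 2 ≤
          ‖b (N + 1)‖ ^ 2 + ‖κ‖ * (1 - ‖κ‖) * ‖geometricFilter κ b N‖ ^ 2 := by
        refine (mul_le_mul_of_nonneg_left (pow_le_pow_left₀ (norm_nonneg _) h1 2) hκ').trans ?_
        nlinarith [mul_nonneg (norm_nonneg κ)
          (sq_nonneg (‖b (N + 1)‖ - (1 - ‖κ‖) * ‖geometricFilter κ b N‖))]
      rw [Finset.sum_range_succ (fun n => ‖geometricFilter κ b n‖ ^ 2) N] at ih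
      linarith
  rw [Finset.sum_range_succ _ N] at h ⊢
  have : 0 ≤ (1 - ‖κ‖) * ‖κ‖ * ‖geometricFilter κ b N‖ ^ 2 := by positivity
  nlinarith

/-- The filter undoes the coefficients `c (n+1) - κ * c n`; the argument is `T z` because the series
starts at the first iterate. -/
theorem sum_iterate_eq_reversedMartingale (T : ℂ → ℂ) (κ : ℂ) (b : ℕ → ℂ) (N : ℕ) (z : ℂ) :
    ∑ n ∈ Finset.range (N + 1), b n * T^[n + 1] z =
      reversedMartingale T κ N (geometricFilter κ b) (T z) := by
  rw [reversedMartingale_eq_sum, Finset.sum_range_succ', add_comm]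
  simp [geometricFilter]

/-! ### Finite sums of iterates -/

namespace IsInnerBoundaryMap

variable {T : ℂ → ℂ} {l : ℂ}

theorem isCircleBounded_sum (hT : IsInnerBoundaryMap T l) (b : ℕ → ℂ) (s : Finset ℕ) :
    IsCircleBounded fun z => ∑ n ∈ s, b n * T^[n + 1] z :=
  IsCircleBounded.sum fun _ _ => (IsCircleBounded.const _).mul (hT.isCircleBounded_iterate _)

theorem integral_norm_pow_sum (hT : IsInnerBoundaryMap T l) (b : ℕ → ℂ) (N p : ℕ) :
    ∫ z, ‖∑ n ∈ Finset.range (N + 1), b n * T^[n + 1] z‖ ^ p ∂circleMeasure =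
      ∫ z, ‖reversedMartingale T (conj l) N (geometricFilter (conj l) b) z‖ ^ p ∂circleMeasure := by
  simp_rw [sum_iterate_eq_reversedMartingale T (conj l)]
  exact hT.integral_comp
    ((hT.isCircleBounded_reversedMartingale N (geometricFilter (conj l) b)).integrable_norm_pow p).1

theorem integral_norm_sq_sum_le (hT : IsInnerBoundaryMap T l) (hl : ‖l‖ ≤ 1) (b : ℕ → ℂ) (N : ℕ) :
    (1 - ‖l‖) ^ 2 * ∫ z, ‖∑ n ∈ Finset.range N, b n * T^[n + 1] z‖ ^ 2 ∂circleMeasure ≤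
      ∑ n ∈ Finset.range N, ‖b n‖ ^ 2 := by
  cases N with
  | zero => simp
  | succ N =>
    rw [hT.integral_norm_pow_sum]
    have h1 := hT.integral_norm_sq_reversedMartingale_le N (geometricFilter (conj l) b)
    have h2 := geometricFilter_sum_norm_sq_le (κ := conj l) (by simpa using hl) b N
    rw [RCLike.norm_conj] at h2
    exact (mul_le_mul_of_nonneg_left h1 (sq_nonneg _)).trans h2

/-- The constant is `(1 - |l|²) / (1 + |l|)² = (1 - |l|) / (1 + |l|)`, from orthogonality and the
filter comparison. -/
theorem le_integral_norm_sq_sum (hT : IsInnerBoundaryMap T l) (hl : ‖l‖ ≤ 1) (b : ℕ → ℂ) (N : ℕ) :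
    (1 - ‖l‖) * ∑ n ∈ Finset.range N, ‖b n‖ ^ 2 ≤
      (1 + ‖l‖) * ∫ z, ‖∑ n ∈ Finset.range N, b n * T^[n + 1] z‖ ^ 2 ∂circleMeasure := by
  cases N with
  | zero => simp
  | succ N =>
    rw [hT.integral_norm_pow_sum]
    have h1 := hT.le_integral_norm_sq_reversedMartingale N (geometricFilter (conj l) b)
    have h2 := sum_norm_sq_le_geometricFilter (conj l) b N
    rw [RCLike.norm_conj] at h2
    have h3 := mul_le_mul_of_nonneg_left h2 (sub_nonneg.2 hl)
    have h4 := mul_le_mul_of_nonneg_left h1 (by positivity : 0 ≤ 1 + ‖l‖)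
    linarith

theorem integral_norm_pow_four_sum_le (hT : IsInnerBoundaryMap T l) (hl : ‖l‖ ≤ 1) (b : ℕ → ℂ)
    (N : ℕ) :
    (1 - ‖l‖) ^ 4 * ∫ z, ‖∑ n ∈ Finset.range N, b n * T^[n + 1] z‖ ^ 4 ∂circleMeasure ≤
      48 * (∑ n ∈ Finset.range N, ‖b n‖ ^ 2) ^ 2 := by
  cases N with
  | zero => simp
  | succ N =>
    rw [hT.integral_norm_pow_sum]
    have h1 := hT.integral_norm_pow_four_reversedMartingale_le hl N (geometricFilter (conj l) b)
    have h2 := geometricFilter_sum_norm_sq_le (κ := conj l) (by simpa using hl) b N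
    rw [RCLike.norm_conj] at h2
    have h3 := pow_le_pow_left₀ (by positivity) h2 2
    have h4 := mul_le_mul_of_nonneg_left h1 (by positivity : 0 ≤ (1 - ‖l‖) ^ 4)
    nlinarith

/-- Coefficients off `s` are set to zero. Arbitrary finite sets are what the Cauchy criterion for
unconditional summability needs. -/
theorem integral_norm_sq_finsetSum_le (hT : IsInnerBoundaryMap T l) (hl : ‖l‖ ≤ 1) (b : ℕ → ℂ)
    (s : Finset ℕ) :
    (1 - ‖l‖) ^ 2 * ∫ z, ‖∑ n ∈ s, b n * T^[n + 1] z‖ ^ 2 ∂circleMeasure ≤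
      ∑ n ∈ s, ‖b n‖ ^ 2 := by
  obtain ⟨N, hN⟩ := s.exists_nat_subset_range
  have := hT.integral_norm_sq_sum_le hl (fun n => if n ∈ s then b n else 0) N
  have h1 (z : ℂ) : ∑ n ∈ Finset.range N, (if n ∈ s then b n else 0) * T^[n + 1] z =
      ∑ n ∈ s, b n * T^[n + 1] z := by
    simp_rw [ite_mul, zero_mul]
    rw [Finset.sum_ite_mem, Finset.inter_eq_right.2 hN]
  have h2 : ∑ n ∈ Finset.range N, ‖if n ∈ s then b n else 0‖ ^ 2 = ∑ n ∈ s, ‖b n‖ ^ 2 := by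
    have (n : ℕ) : ‖if n ∈ s then b n else 0‖ ^ 2 = if n ∈ s then ‖b n‖ ^ 2 else 0 := by
      split_ifs <;> simp
    simp_rw [this]
    rw [Finset.sum_ite_mem, Finset.inter_eq_right.2 hN]
  simpa only [h1, h2] using this

theorem integral_iterate_mul_conj (hT : IsInnerBoundaryMap T l) (n k : ℕ) :
    ∫ z, T^[n + k] z * conj (T^[n] z) ∂circleMeasure = l ^ k := by
  have := congrArg conj (hT.integral_mul_conj_iterate n k)
  rw [← integral_conj] at this
  simpa [mul_comm] using this

theorem integral_norm_sq_sum_eq (hT : IsInnerBoundaryMap T l) (b : ℕ → ℂ) (N : ℕ) :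
    ∫ z, ‖∑ n ∈ Finset.range N, b n * T^[n + 1] z‖ ^ 2 ∂circleMeasure =
      ∑ n ∈ Finset.range N, ‖b n‖ ^ 2 +
        2 * (∑ j ∈ Finset.range N, ∑ n ∈ Finset.range j, l ^ (j - n) * (conj (b n) * b j)).re := by
  induction N with
  | zero => simp
  | succ N ih =>
    have hS := hT.isCircleBounded_sum b (Finset.range N)
    have hF : IsCircleBounded fun z => b N * T^[N + 1] z :=
      (IsCircleBounded.const _).mul (hT.isCircleBounded_iterate _)
    have h1 := hS.integrable_norm_pow 2
    have h2 := hF.integrable_norm_pow 2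
    have h3 := (hF.mul hS.conjugate).integrable
    have h3re := integrable_re_circleMeasure h3
    have h21 : Integrable (fun z => ‖b N * T^[N + 1] z‖ ^ 2 +
      ‖∑ n ∈ Finset.range N, b n * T^[n + 1] z‖ ^ 2) circleMeasure := h2.add h1
    have e2 : ∫ z, ‖b N * T^[N + 1] z‖ ^ 2 ∂circleMeasure = ‖b N‖ ^ 2 := by
      have (z : ℂ) : ‖b N * T^[N + 1] z‖ ^ 2 = ‖b N‖ ^ 2 := by
        rw [norm_mul, Function.iterate_succ_apply', hT.norm_eq_one, mul_one]
      simp only [this, integral_const, probReal_univ, one_smul]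
    have e3 : ∫ z, b N * T^[N + 1] z * conj (∑ n ∈ Finset.range N, b n * T^[n + 1] z)
        ∂circleMeasure = ∑ n ∈ Finset.range N, l ^ (N - n) * (conj (b n) * b N) := by
      have (z : ℂ) : b N * T^[N + 1] z * conj (∑ n ∈ Finset.range N, b n * T^[n + 1] z) =
          ∑ n ∈ Finset.range N, conj (b n) * b N * (T^[N + 1] z * conj (T^[n + 1] z)) := by
        rw [map_sum, Finset.mul_sum]
        refine Finset.sum_congr rfl fun n _ => ?_
        rw [map_mul]; ring
      simp_rw [this]
      rw [integral_finsetSum _ fun n _ => (((hT.isCircleBounded_iterate (N + 1)).mul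
        (hT.isCircleBounded_iterate (n + 1)).conjugate).integrable.const_mul _)]
      refine Finset.sum_congr rfl fun n hn => ?_
      have hn' : N + 1 = (n + 1) + (N - n) := by have := Finset.mem_range.1 hn; omega
      rw [integral_const_mul, hn', hT.integral_iterate_mul_conj]
      ring
    simp_rw [Finset.sum_range_succ _ N, add_comm (∑ n ∈ Finset.range N, b n * T^[n + 1] _),
      Complex.norm_add_sq]
    rw [integral_add h21 (h3re.const_mul 2), integral_add h2 h1, integral_const_mul,
      integral_re_circleMeasure h3, e2, e3, ih, Complex.add_re]
    ring

theorem integral_sum_mul_self (hT : IsInnerBoundaryMap T l) (b : ℕ → ℂ) (N : ℕ) :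
    ∫ z, (∑ n ∈ Finset.range N, b n * T^[n + 1] z) * (∑ n ∈ Finset.range N, b n * T^[n + 1] z)
      ∂circleMeasure = 0 := by
  have h (m n : ℕ) : ∫ z, T^[m] z * T^[n] z ∂circleMeasure = 0 := by
    obtain h | h := le_total m n
    · obtain ⟨k, rfl⟩ := Nat.exists_eq_add_of_le h
      exact hT.integral_mul_iterate m k
    · obtain ⟨k, rfl⟩ := Nat.exists_eq_add_of_le h
      simpa only [mul_comm] using hT.integral_mul_iterate n k
  have hi (m n : ℕ) : Integrable (fun z => b m * T^[m + 1] z * (b n * T^[n + 1] z)) circleMeasure :=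
    (((IsCircleBounded.const _).mul (hT.isCircleBounded_iterate _)).mul
      ((IsCircleBounded.const _).mul (hT.isCircleBounded_iterate _))).integrable
  simp_rw [Finset.sum_mul_sum]
  rw [integral_finsetSum _ fun m _ => integrable_finsetSum _ fun n _ => hi m n]
  refine Finset.sum_eq_zero fun m _ => ?_
  rw [integral_finsetSum _ fun n _ => hi m n]
  refine Finset.sum_eq_zero fun n _ => ?_
  have (z : ℂ) : b m * T^[m + 1] z * (b n * T^[n + 1] z) =
      b m * b n * (T^[m + 1] z * T^[n + 1] z) := by ring
  simp_rw [this]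
  rw [integral_const_mul, h, mul_zero]

/-- `(Re w)² = (|w|² + Re w²) / 2`, and the integral of the square of the sum is zero. -/
theorem integral_re_sum_sq (hT : IsInnerBoundaryMap T l) (b : ℕ → ℂ) (N : ℕ) (t : ℂ) :
    ∫ z, (conj t * ∑ n ∈ Finset.range N, b n * T^[n + 1] z).re ^ 2 ∂circleMeasure =
      1 / 2 * ‖t‖ ^ 2 *
        ∫ z, ‖∑ n ∈ Finset.range N, b n * T^[n + 1] z‖ ^ 2 ∂circleMeasure := by
  have hS := hT.isCircleBounded_sum b (Finset.range N)
  have h2 := (hS.mul hS).integrable.const_mul (conj t ^ 2)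
  have h2re := integrable_re_circleMeasure h2
  have h (x s : ℂ) : (x * s).re ^ 2 =
      1 / 2 * ‖x‖ ^ 2 * ‖s‖ ^ 2 + 1 / 2 * (x ^ 2 * (s * s)).re := by
    rw [← Complex.normSq_eq_norm_sq, ← Complex.normSq_eq_norm_sq, Complex.normSq_apply,
      Complex.normSq_apply]
    simp only [pow_two, Complex.mul_re, Complex.mul_im]
    ring
  simp_rw [h, RCLike.norm_conj]
  rw [integral_add ((hS.integrable_norm_pow 2).const_mul _) (h2re.const_mul _), integral_const_mul,
    integral_const_mul, integral_re_circleMeasure h2, integral_const_mul, hT.integral_sum_mul_self]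
  simp

end IsInnerBoundaryMap

/-! ### The correlation series -/

section Correlation

variable {b : ℕ → ℂ}

theorem summable_norm_mul_shift (hb : Summable fun n => ‖b n‖ ^ 2) (k : ℕ) :
    Summable (fun n => ‖b n‖ * ‖b (n + k)‖) ∧
      ∑' n, ‖b n‖ * ‖b (n + k)‖ ≤ ∑' n, ‖b n‖ ^ 2 := by
  have hk : Summable fun n => ‖b (n + k)‖ ^ 2 :=
    (summable_nat_add_iff (f := fun n => ‖b n‖ ^ 2) k).2 hb
  have hle (n : ℕ) : ‖b n‖ * ‖b (n + k)‖ ≤ 1 / 2 * (‖b n‖ ^ 2 + ‖b (n + k)‖ ^ 2) := by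
    nlinarith [sq_nonneg (‖b n‖ - ‖b (n + k)‖)]
  have hs := (hb.add hk).mul_left (1 / 2 : ℝ)
  have h1 : Summable (fun n => ‖b n‖ * ‖b (n + k)‖) :=
    Summable.of_nonneg_of_le (fun _ => by positivity) hle hs
  refine ⟨h1, (h1.tsum_le_tsum hle hs).trans ?_⟩
  rw [tsum_mul_left, hb.tsum_add hk]
  have := hb.sum_add_tsum_nat_add k
  have h0 : 0 ≤ ∑ n ∈ Finset.range k, ‖b n‖ ^ 2 := Finset.sum_nonneg fun _ _ => by positivity
  linarith

theorem summable_conj_mul_shift (hb : Summable fun n => ‖b n‖ ^ 2) (k : ℕ) :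
    Summable fun n => conj (b n) * b (n + k) :=
  Summable.of_norm (by simpa using (summable_norm_mul_shift hb k).1)

theorem norm_tsum_conj_mul_shift_le (hb : Summable fun n => ‖b n‖ ^ 2) (k : ℕ) :
    ‖∑' n, conj (b n) * b (n + k)‖ ≤ ∑' n, ‖b n‖ ^ 2 := by
  refine (norm_tsum_le_tsum_norm ?_).trans ?_
  · simpa using (summable_norm_mul_shift hb k).1
  · simpa using (summable_norm_mul_shift hb k).2

theorem norm_pow_mul_tsum_shift_le (hb : Summable fun n => ‖b n‖ ^ 2) (l : ℂ) (k : ℕ) :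
    ‖l ^ (k + 1) * ∑' n, conj (b n) * b (n + (k + 1))‖ ≤
      ‖l‖ ^ k * (‖l‖ * ∑' n, ‖b n‖ ^ 2) := by
  rw [norm_mul, norm_pow, pow_succ, mul_assoc]
  exact mul_le_mul_of_nonneg_left (mul_le_mul_of_nonneg_left
    (norm_tsum_conj_mul_shift_le hb (k + 1)) (norm_nonneg _)) (by positivity)

theorem summable_pow_mul_tsum_shift (hb : Summable fun n => ‖b n‖ ^ 2) {l : ℂ} (hl : ‖l‖ < 1) :
    Summable fun k : ℕ => l ^ (k + 1) * ∑' n, conj (b n) * b (n + (k + 1)) :=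
  Summable.of_norm_bounded ((summable_geometric_of_lt_one (norm_nonneg l) hl).mul_right _)
    (norm_pow_mul_tsum_shift_le hb l)

theorem norm_tsum_pow_mul_tsum_shift_le (hb : Summable fun n => ‖b n‖ ^ 2) {l : ℂ}
    (hl : ‖l‖ < 1) :
    ‖∑' k : ℕ, l ^ (k + 1) * ∑' n, conj (b n) * b (n + (k + 1))‖ ≤
      ‖l‖ / (1 - ‖l‖) * ∑' n, ‖b n‖ ^ 2 := by
  have := tsum_of_norm_bounded
    ((hasSum_geometric_of_lt_one (norm_nonneg l) hl).mul_right (‖l‖ * ∑' n, ‖b n‖ ^ 2))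
    (norm_pow_mul_tsum_shift_le hb l)
  refine this.trans_eq ?_
  ring

/-- The triangular sums are partial sums, along antidiagonals, of an absolutely summable double
series in the lag and the starting index. -/
theorem tendsto_sum_pow_mul_conj_mul (hb : Summable fun n => ‖b n‖ ^ 2) {l : ℂ} (hl : ‖l‖ < 1) :
    Tendsto (fun N => ∑ j ∈ Finset.range N, ∑ n ∈ Finset.range j, l ^ (j - n) * (conj (b n) * b j))
      atTop (𝓝 (∑' k : ℕ, l ^ (k + 1) * ∑' n, conj (b n) * b (n + (k + 1)))) := by
  let v : ℕ × ℕ → ℂ := fun p => l ^ (p.1 + 1) * (conj (b p.2) * b (p.2 + (p.1 + 1)))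
  have hrow (k : ℕ) : Summable fun n => ‖v (k, n)‖ := by
    simpa [v, mul_assoc] using (summable_norm_mul_shift hb (k + 1)).1.mul_left (‖l‖ ^ (k + 1))
  have hv : Summable v := by
    refine Summable.of_norm ((summable_prod_of_nonneg fun _ => norm_nonneg _).2 ⟨hrow, ?_⟩)
    refine Summable.of_nonneg_of_le (fun _ => tsum_nonneg fun _ => norm_nonneg _) (fun k => ?_)
      ((summable_geometric_of_lt_one (norm_nonneg l) hl).mul_right (‖l‖ * ∑' n, ‖b n‖ ^ 2))
    simp only [v, norm_mul, norm_pow, RCLike.norm_conj, tsum_mul_left]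
    rw [pow_succ, mul_assoc]
    exact mul_le_mul_of_nonneg_left (mul_le_mul_of_nonneg_left
      (summable_norm_mul_shift hb (k + 1)).2 (norm_nonneg _)) (by positivity)
  have hsum : ∑' p, v p = ∑' k : ℕ, l ^ (k + 1) * ∑' n, conj (b n) * b (n + (k + 1)) := by
    rw [hv.tsum_prod' fun k => (hrow k).of_norm]
    simp only [v, tsum_mul_left]
  have h1 : HasSum (v ∘ Finset.HasAntidiagonal.sigmaAntidiagonalEquivProd) (∑' p, v p) :=
    (Equiv.hasSum_iff _).2 hv.hasSum
  have h2 : HasSum (fun m => ∑ p ∈ Finset.HasAntidiagonal.antidiagonal m, v p) (∑' p, v p) :=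
    h1.sigma fun m => Finset.hasSum (Finset.HasAntidiagonal.antidiagonal m) v
  have h3 := h2.tendsto_sum_nat
  rw [hsum] at h3
  -- The inner sum for `j = 0` is empty, and `j = m + 1` matches the antidiagonal `m` because lags
  -- start at 1.
  refine (tendsto_add_atTop_iff_nat 1).1 (h3.congr fun N => ?_)
  rw [Finset.sum_range_succ']
  simp only [Finset.range_zero, Finset.sum_empty, add_zero]
  refine Finset.sum_congr rfl fun m _ => ?_
  rw [← Finset.Nat.sum_antidiagonal_swap, Finset.Nat.sum_antidiagonal_eq_sum_range_succ_mk]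
  refine Finset.sum_congr rfl fun n hn => ?_
  have hn' := Finset.mem_range.1 hn
  simp only [v, Prod.swap]
  rw [show m - n + 1 = m + 1 - n by omega, show n + (m + 1 - n) = m + 1 by omega]

end Correlation

/-! ### Passage to `L²(m)` -/

section Lp

theorem norm_toLp_sq {E : Type*} [NormedAddCommGroup E] {g : ℂ → E} (hg : MemLp g 2 circleMeasure) :
    ‖hg.toLp g‖ ^ 2 = ∫ z, ‖g z‖ ^ 2 ∂circleMeasure := by
  rw [Lp.norm_toLp, hg.eLpNorm_eq_integral_rpow_norm (by simp) (by simp),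
    ENNReal.toReal_ofReal (by positivity), ← Real.rpow_mul_natCast (by positivity)]
  simp

theorem eLpNorm_four_le_ofReal {g : ℂ → ℂ} (hg : MemLp g 4 circleMeasure) {K : ℝ} (hK : 0 ≤ K)
    (h : ∫ z, ‖g z‖ ^ 4 ∂circleMeasure ≤ K ^ 4) :
    eLpNorm g 4 circleMeasure ≤ ENNReal.ofReal K := by
  rw [hg.eLpNorm_eq_integral_rpow_norm (by simp) (by simp)]
  refine ENNReal.ofReal_le_ofReal ?_
  have h4 : ((4 : ℝ≥0∞).toReal) = ((4 : ℕ) : ℝ) := by simp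
  simp only [h4, Real.rpow_natCast]
  refine (Real.rpow_le_rpow (by positivity) h (by positivity)).trans_eq ?_
  exact Real.pow_rpow_inv_natCast hK (by norm_num)

theorem memLp_poissonKernel {w : ℂ} (hw : w ∈ Metric.ball (0 : ℂ) 1) :
    MemLp (fun z => (poissonKernel 0 w z : ℂ)) 2 circleMeasure := by
  refine MemLp.of_bound (Complex.measurable_ofReal.comp
    (measurable_poissonKernel w)).aestronglyMeasurable ((1 + ‖w‖) / (1 - ‖w‖)) ?_
  filter_upwards [ae_norm_eq_one_circleMeasure] with z hz
  simpa using norm_poissonKernel_le_of_norm_eq_one hw hz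

/-- Makes the Poisson integral at `w` a continuous functional on L²; the kernel is real, so
conjugating it is harmless. -/
theorem poissonExtension_eq_inner {w : ℂ} (hw : w ∈ Metric.ball (0 : ℂ) 1) {g : ℂ → ℂ}
    (hg : MemLp g 2 circleMeasure) :
    poissonExtension g w = inner ℂ ((memLp_poissonKernel hw).toLp _) (hg.toLp g) := by
  rw [L2.inner_def]
  refine integral_congr_ae ?_
  filter_upwards [(memLp_poissonKernel hw).coeFn_toLp, hg.coeFn_toLp] with z h1 h2
  rw [h1, h2]
  simp [mul_comm]

end Lp

/-! ### Infinite sums of iterates -/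

namespace IsInnerBoundaryMap

variable {T : ℂ → ℂ} {l : ℂ}

theorem memLp_sum (hT : IsInnerBoundaryMap T l) (b : ℕ → ℂ) (s : Finset ℕ) (p : ℝ≥0∞) :
    MemLp (fun z => ∑ n ∈ s, b n * T^[n + 1] z) p circleMeasure :=
  (hT.isCircleBounded_sum b s).memLp p

theorem memLp_term (hT : IsInnerBoundaryMap T l) (b : ℕ → ℂ) (n : ℕ) :
    MemLp (fun z => b n * T^[n + 1] z) 2 circleMeasure :=
  ((IsCircleBounded.const _).mul (hT.isCircleBounded_iterate _)).memLp 2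

theorem sum_toLp (hT : IsInnerBoundaryMap T l) (b : ℕ → ℂ) (s : Finset ℕ) :
    ∑ n ∈ s, (hT.memLp_term b n).toLp _ = (hT.memLp_sum b s 2).toLp _ := by
  classical
  induction s using Finset.induction_on with
  | empty => simp
  | insert i s hi ih =>
    rw [Finset.sum_insert hi, ih, ← MemLp.toLp_add, MemLp.toLp_eq_toLp_iff]
    exact .of_forall fun z => by simp [Finset.sum_insert hi]

theorem summable_toLp (hT : IsInnerBoundaryMap T l) (hl : ‖l‖ < 1) {b : ℕ → ℂ}
    (hb : Summable fun n => ‖b n‖ ^ 2) : Summable fun n => (hT.memLp_term b n).toLp _ := by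
  rw [summable_iff_vanishing_norm]
  intro ε hε
  have hl' : 0 < 1 - ‖l‖ := sub_pos.2 hl
  obtain ⟨s, hs⟩ := summable_iff_vanishing_norm.1 hb (((1 - ‖l‖) * ε) ^ 2) (by positivity)
  refine ⟨s, fun t ht => ?_⟩
  have h1 := (le_abs_self _).trans_lt (hs t ht)
  have h2 := hT.integral_norm_sq_finsetSum_le hl.le b t
  rw [hT.sum_toLp b t]
  rw [← norm_toLp_sq (hT.memLp_sum b t 2), ← mul_pow] at h2
  have h3 := lt_of_pow_lt_pow_left₀ 2 (by positivity) (h2.trans_lt h1)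
  exact lt_of_mul_lt_mul_left h3 hl'.le

theorem tendsto_eLpNorm_iff (hT : IsInnerBoundaryMap T l) (hl : ‖l‖ < 1) {b : ℕ → ℂ}
    (hb : Summable fun n => ‖b n‖ ^ 2) {ξ : ℂ → ℂ} (hξ : MemLp ξ 2 circleMeasure) :
    Tendsto (fun N => eLpNorm (fun z => ξ z - ∑ n ∈ Finset.range N, b n * T^[n + 1] z) 2
      circleMeasure) atTop (𝓝 0) ↔
      HasSum (fun n => (hT.memLp_term b n).toLp _) (hξ.toLp ξ) := by
  rw [(hT.summable_toLp hl hb).hasSum_iff_tendsto_nat]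
  simp_rw [hT.sum_toLp b]
  rw [Lp.tendsto_Lp_iff_tendsto_eLpNorm'' _ (fun N => hT.memLp_sum b (Finset.range N) 2) ξ hξ]
  refine tendsto_congr fun N => ?_
  rw [← eLpNorm_neg]
  congr 1
  ext z
  simp

section Sum

variable {b : ℕ → ℂ} {ξ : ℂ → ℂ}

theorem tendsto_integral_norm_sq_sum (hT : IsInnerBoundaryMap T l) (hl : ‖l‖ < 1)
    (hb : Summable fun n => ‖b n‖ ^ 2) :
    Tendsto (fun N => ∫ z, ‖∑ n ∈ Finset.range N, b n * T^[n + 1] z‖ ^ 2 ∂circleMeasure) atTop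
      (𝓝 (∑' n, ‖b n‖ ^ 2 +
        2 * (∑' k : ℕ, l ^ (k + 1) * ∑' n, conj (b n) * b (n + (k + 1))).re)) := by
  simp_rw [hT.integral_norm_sq_sum_eq]
  exact hb.hasSum.tendsto_sum_nat.add
    (((Complex.continuous_re.tendsto _).comp (tendsto_sum_pow_mul_conj_mul hb hl)).const_mul 2)

theorem integral_norm_sq_eq (hT : IsInnerBoundaryMap T l) (hl : ‖l‖ < 1)
    (hb : Summable fun n => ‖b n‖ ^ 2) (hξ : MemLp ξ 2 circleMeasure)
    (hs : HasSum (fun n => (hT.memLp_term b n).toLp _) (hξ.toLp ξ)) :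
    ∫ z, ‖ξ z‖ ^ 2 ∂circleMeasure = ∑' n, ‖b n‖ ^ 2 +
        2 * (∑' k : ℕ, l ^ (k + 1) * ∑' n, conj (b n) * b (n + (k + 1))).re := by
  rw [← norm_toLp_sq hξ]
  refine tendsto_nhds_unique ?_ (hT.tendsto_integral_norm_sq_sum hl hb)
  have := hs.tendsto_sum_nat.norm.pow 2
  simpa only [hT.sum_toLp b, norm_toLp_sq] using this

theorem hasSum_poissonExtension (hT : IsInnerBoundaryMap T l) (hξ : MemLp ξ 2 circleMeasure)
    (hs : HasSum (fun n => (hT.memLp_term b n).toLp _) (hξ.toLp ξ)) {w : ℂ}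
    (hw : w ∈ Metric.ball (0 : ℂ) 1) :
    HasSum (fun n => b n * poissonExtension T^[n + 1] w) (poissonExtension ξ w) := by
  have := hs.mapL (innerSL ℂ ((memLp_poissonKernel hw).toLp _))
  simp only [innerSL_apply_apply, ← poissonExtension_eq_inner hw] at this
  have hterm : (fun n => b n * poissonExtension T^[n + 1] w) =
      fun n => poissonExtension (fun z => b n * T^[n + 1] z) w := by
    funext n
    unfold poissonExtension
    rw [← integral_const_mul]
    congr 1; ext z
    simp only [Complex.real_smul]; ring
  rw [hterm]
  exact this

theorem integral_re_sq_eq (hT : IsInnerBoundaryMap T l) (hξ : MemLp ξ 2 circleMeasure)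
    (hs : HasSum (fun n => (hT.memLp_term b n).toLp _) (hξ.toLp ξ)) (t : ℂ) :
    ∫ z, (conj t * ξ z).re ^ 2 ∂circleMeasure =
      1 / 2 * ‖t‖ ^ 2 * ∫ z, ‖ξ z‖ ^ 2 ∂circleMeasure := by
  -- Taking real parts is only real-linear, so it acts on L² as a continuous real-linear map,
  -- through which the finite identity passes to the limit.
  let L : ℂ →L[ℝ] ℝ := Complex.reCLM ∘L (ContinuousLinearMap.mul ℝ ℂ (conj t))
  have hL {g : ℂ → ℂ} (hg : MemLp g 2 circleMeasure) :
      ‖L.compLpL 2 circleMeasure (hg.toLp g)‖ ^ 2 = ∫ z, (conj t * g z).re ^ 2 ∂circleMeasure := by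
    have h1 : L.compLpL 2 circleMeasure (hg.toLp g) = (L.comp_memLp' hg).toLp _ := by
      refine Lp.ext ?_
      filter_upwards [L.coeFn_compLpL (hg.toLp g), hg.coeFn_toLp, (L.comp_memLp' hg).coeFn_toLp]
        with z h1 h2 h3
      rw [h1, h2, h3]; rfl
    rw [h1, norm_toLp_sq]
    congr 1; ext z
    rw [Real.norm_eq_abs, sq_abs]; rfl
  have h1 := (((L.compLpL 2 circleMeasure).continuous.tendsto _).comp hs.tendsto_sum_nat).norm.pow 2
  have h2 := (hs.tendsto_sum_nat.norm.pow 2).const_mul (1 / 2 * ‖t‖ ^ 2)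
  simp only [Function.comp_apply, hT.sum_toLp b, hL, hT.integral_re_sum_sq] at h1
  simp only [hT.sum_toLp b, norm_toLp_sq] at h2
  exact tendsto_nhds_unique h1 h2

theorem le_integral_norm_sq (hT : IsInnerBoundaryMap T l) (hl : ‖l‖ < 1)
    (hb : Summable fun n => ‖b n‖ ^ 2) :
    (1 - ‖l‖) * ∑' n, ‖b n‖ ^ 2 ≤ (1 + ‖l‖) * (∑' n, ‖b n‖ ^ 2 +
        2 * (∑' k : ℕ, l ^ (k + 1) * ∑' n, conj (b n) * b (n + (k + 1))).re) :=
  le_of_tendsto_of_tendsto' (hb.hasSum.tendsto_sum_nat.const_mul _)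
    ((hT.tendsto_integral_norm_sq_sum hl hb).const_mul _)
    fun N => hT.le_integral_norm_sq_sum hl.le b N

theorem eLpNorm_four_le (hT : IsInnerBoundaryMap T l) (hl : ‖l‖ < 1)
    (hb : Summable fun n => ‖b n‖ ^ 2) (hξ : MemLp ξ 2 circleMeasure)
    (hs : HasSum (fun n => (hT.memLp_term b n).toLp _) (hξ.toLp ξ)) :
    eLpNorm ξ 4 circleMeasure ≤
      ENNReal.ofReal (3 * (1 + ‖l‖) / (1 - ‖l‖) ^ 2) * eLpNorm ξ 2 circleMeasure := by
  have hl' : 0 < 1 - ‖l‖ := sub_pos.2 hl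
  have hA := hT.le_integral_norm_sq hl hb
  rw [← hT.integral_norm_sq_eq hl hb hξ hs, ← norm_toLp_sq hξ] at hA
  have h2 : eLpNorm ξ 2 circleMeasure = ENNReal.ofReal ‖hξ.toLp ξ‖ := by
    rw [Lp.norm_toLp, ENNReal.ofReal_toReal hξ.2.ne]
  rw [h2, ← ENNReal.ofReal_mul (by positivity)]
  set X := ‖hξ.toLp ξ‖
  have hX : 0 ≤ X := norm_nonneg _
  have hbound (N : ℕ) : eLpNorm (fun z => ∑ n ∈ Finset.range N, b n * T^[n + 1] z) 4
      circleMeasure ≤ ENNReal.ofReal (3 * (1 + ‖l‖) / (1 - ‖l‖) ^ 2 * X) := by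
    refine eLpNorm_four_le_ofReal (hT.memLp_sum b _ 4) (by positivity) ?_
    have h4 := hT.integral_norm_pow_four_sum_le hl.le b N
    have hN : ∑ n ∈ Finset.range N, ‖b n‖ ^ 2 ≤ ∑' n, ‖b n‖ ^ 2 :=
      hb.sum_le_tsum _ fun _ _ => by positivity
    have h5 : (1 - ‖l‖) * ∑ n ∈ Finset.range N, ‖b n‖ ^ 2 ≤ (1 + ‖l‖) * X ^ 2 :=
      (mul_le_mul_of_nonneg_left hN hl'.le).trans hA
    have h6 := pow_le_pow_left₀ (by positivity) h5 2
    -- The powers are raised beyond need, and `48 ≤ 3⁴` used, so that the right side is a perfect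
    -- fourth power.
    have h7 : (1 - ‖l‖) ^ 8 * ∫ z, ‖∑ n ∈ Finset.range N, b n * T^[n + 1] z‖ ^ 4 ∂circleMeasure ≤
        (3 * (1 + ‖l‖) * X) ^ 4 := by
      have e1 := mul_le_mul_of_nonneg_left h4 (by positivity : 0 ≤ (1 - ‖l‖) ^ 4)
      have e2 : (1 - ‖l‖) ^ 4 * (∑ n ∈ Finset.range N, ‖b n‖ ^ 2) ^ 2 ≤
          ((1 + ‖l‖) * X ^ 2) ^ 2 := by
        refine le_trans ?_ h6
        rw [mul_pow]
        refine mul_le_mul_of_nonneg_right ?_ (by positivity)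
        exact pow_le_pow_of_le_one hl'.le (by linarith [norm_nonneg l]) (by norm_num)
      have e3 : ((1 + ‖l‖) * X ^ 2) ^ 2 ≤ (1 + ‖l‖) ^ 4 * X ^ 4 := by
        rw [mul_pow, ← pow_mul]
        refine mul_le_mul_of_nonneg_right ?_ (by positivity)
        exact pow_le_pow_right₀ (by linarith [norm_nonneg l]) (by norm_num)
      have e4 : 0 ≤ (1 + ‖l‖) ^ 4 * X ^ 4 := by positivity
      nlinarith
    have : (3 * (1 + ‖l‖) / (1 - ‖l‖) ^ 2 * X) ^ 4 =
        (3 * (1 + ‖l‖) * X) ^ 4 / (1 - ‖l‖) ^ 8 := by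
      field_simp
    rw [this, le_div_iff₀ (by positivity), mul_comm]
    exact h7
  -- L² convergence gives convergence in measure, under which the L⁴ norm is lower semicontinuous;
  -- `ξ` is not assumed to be in L⁴.
  have hm : TendstoInMeasure circleMeasure
      (fun N z => ∑ n ∈ Finset.range N, b n * T^[n + 1] z) atTop ξ := by
    refine tendstoInMeasure_of_tendsto_eLpNorm (p := 2) (by simp)
      (fun N => (hT.memLp_sum b _ 2).1) hξ.1 ?_
    have := (hT.tendsto_eLpNorm_iff hl hb hξ).2 hs
    refine this.congr fun N => ?_
    rw [← eLpNorm_neg]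
    congr 1
    ext z
    simp
  exact eLpNorm_le_of_tendstoInMeasure (.of_forall hbound) hm fun N => (hT.memLp_sum b _ 2).1

end Sum

/-- The exceptional null set pulls back to null sets because iterates of `T` preserve the measure.
-/
theorem iterate_ae_eq (hT : IsInnerBoundaryMap T l) {S : ℂ → ℂ} (h : T =ᵐ[circleMeasure] S)
    (n : ℕ) : T^[n] =ᵐ[circleMeasure] S^[n] := by
  induction n with
  | zero => rfl
  | succ n ih =>
    have := (hT.measurePreserving.iterate n).quasiMeasurePreserving.ae h
    filter_upwards [ih, this] with z h1 h2
    rw [Function.iterate_succ_apply', Function.iterate_succ_apply', ← h1, h2]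

end IsInnerBoundaryMap

/-! ### The theorem -/

theorem IsInnerFunction.isInnerBoundaryMap {f T : ℂ → ℂ} (hf : IsInnerFunction f) (hf0 : f 0 = 0)
    (hl : ‖deriv f 0‖ ≤ 1) (hT : Measurable T) (hT1 : ∀ z, ‖T z‖ = 1)
    (hr : ∀ᵐ z ∂circleMeasure, Tendsto (fun r : ℝ => f (r * z)) (𝓝[<] 1) (𝓝 (T z))) :
    IsInnerBoundaryMap T (deriv f 0) where
  norm_eq_one := hT1
  measurePreserving := measurePreserving_of_tendsto_radial hf hf0 hT hT1 hr
  integral_mul_comp _ hg := integral_mul_comp hf hf0 hl hT hT1 hr hg.1 hg.2.choose_spec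
  integral_mul_self := by
    simpa using integral_mul_pow isInnerFunction_id (.of_forall tendsto_radial_id) 1

theorem hasBoundarySum_iff {f T : ℂ → ℂ} {l : ℂ} (hT : IsInnerBoundaryMap T l)
    (h : T =ᵐ[circleMeasure] boundaryMap f) {a : ℕ → ℂ} {ξ : ℂ → ℂ} :
    HasBoundarySum f a ξ ↔ MemLp ξ 2 circleMeasure ∧
      Tendsto (fun N => eLpNorm (fun z => ξ z - ∑ n ∈ Finset.range N, a (n + 1) * T^[n + 1] z) 2
        circleMeasure) atTop (𝓝 0) := by
  refine and_congr_right fun _ => tendsto_congr fun N => eLpNorm_congr_ae ?_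
  have hall : ∀ᵐ z ∂circleMeasure, ∀ n, T^[n] z = (boundaryMap f)^[n] z :=
    ae_all_iff.2 fun n => hT.iterate_ae_eq h n
  filter_upwards [hall] with z hz
  have : Finset.Icc 1 N = Finset.Ico 1 (N + 1) := by ext; simp
  rw [this, Finset.sum_Ico_eq_sum_range]
  simp [hz, add_comm]

theorem theorem4 (f : ℂ → ℂ) (hf : IsInnerFunction f) (hf0 : f 0 = 0) (hrot : ¬ IsRotation f) :
    ‖deriv f 0‖ < 1 ∧
    ∃ C : ℝ, 0 < C ∧ ∀ a : ℕ → ℂ, Summable (fun n : ℕ => ‖a (n + 1)‖ ^ 2) →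
      -- all series in the definition of `σ²` converge
      (∀ k : ℕ, Summable fun n : ℕ => (starRingEnd ℂ) (a (n + 1)) * a (n + 1 + k)) ∧
      (Summable fun k : ℕ => deriv f 0 ^ (k + 1) * correlation a (k + 1)) ∧
      -- two-sided bound for `σ²`
      ((1 + ‖deriv f 0‖) / (1 - ‖deriv f 0‖))⁻¹ * ∑' n : ℕ, ‖a (n + 1)‖ ^ 2
        ≤ sigmaSq (deriv f 0) a ∧
      sigmaSq (deriv f 0) a
        ≤ (1 + ‖deriv f 0‖) / (1 - ‖deriv f 0‖) * ∑' n : ℕ, ‖a (n + 1)‖ ^ 2 ∧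
      -- the series defining `ξ` converges in `L²(m)`; its sum `ξ` is the boundary function of the
      -- analytic function `∑ a_n f^n` in the disc, and has the stated properties
      (∃ ξ : ℂ → ℂ, HasBoundarySum f a ξ) ∧
      ∀ ξ : ℂ → ℂ, HasBoundarySum f a ξ →
        (∀ w ∈ Metric.ball (0 : ℂ) 1,
          HasSum (fun n : ℕ => a (n + 1) * f^[n + 1] w) (poissonExtension ξ w)) ∧
        ∫ z, ‖ξ z‖ ^ 2 ∂circleMeasure = sigmaSq (deriv f 0) a ∧
        (∀ t : ℂ, ∫ z, ((starRingEnd ℂ) t * ξ z).re ^ 2 ∂circleMeasure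
          = 1 / 2 * ‖t‖ ^ 2 * sigmaSq (deriv f 0) a) ∧
        eLpNorm ξ 4 circleMeasure ≤ ENNReal.ofReal C * eLpNorm ξ 2 circleMeasure := by
  have hl := norm_deriv_zero_lt_one hf hf0 hrot
  obtain ⟨T, hTm, hT1, hTf, hr⟩ := hf.exists_measurable_boundaryMap
  have hT := hf.isInnerBoundaryMap hf0 hl.le hTm hT1 hr
  have hl' : 0 < 1 - ‖deriv f 0‖ := sub_pos.2 hl
  refine ⟨hl, 3 * (1 + ‖deriv f 0‖) / (1 - ‖deriv f 0‖) ^ 2, by positivity, fun a ha => ?_⟩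
  let b : ℕ → ℂ := fun n => a (n + 1)
  have hb : Summable fun n => ‖b n‖ ^ 2 := ha
  have hcorr (k : ℕ) : correlation a k = ∑' n, conj (b n) * b (n + k) := by
    refine tsum_congr fun n => ?_
    rw [add_right_comm]
  have hσ : sigmaSq (deriv f 0) a = ∑' n, ‖b n‖ ^ 2 +
      2 * (∑' k : ℕ, deriv f 0 ^ (k + 1) * ∑' n, conj (b n) * b (n + (k + 1))).re := by
    simp only [sigmaSq, hcorr]
    rfl
  refine ⟨fun k => ?_, ?_, ?_, ?_, ?_, fun ξ hξ => ?_⟩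
  · simpa only [b, add_right_comm] using summable_conj_mul_shift hb k
  · simpa only [hcorr] using summable_pow_mul_tsum_shift hb hl
  · have := hT.le_integral_norm_sq hl hb
    rw [← hσ] at this
    rw [inv_div, div_mul_eq_mul_div, div_le_iff₀ (by positivity), mul_comm (sigmaSq _ _)]
    exact this
  -- Each correlation is at most `∑ |b n|²`, and `1 + 2 |l| / (1 - |l|) = (1 + |l|) / (1 - |l|)`.
  · have h1 := (Complex.re_le_norm _).trans (norm_tsum_pow_mul_tsum_shift_le hb hl)
    have h2 : (1 + ‖deriv f 0‖) / (1 - ‖deriv f 0‖) * ∑' n, ‖b n‖ ^ 2 =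
        ∑' n, ‖b n‖ ^ 2 + 2 * (‖deriv f 0‖ / (1 - ‖deriv f 0‖) * ∑' n, ‖b n‖ ^ 2) := by
      field_simp
      ring
    rw [hσ]
    exact (add_le_add_right (mul_le_mul_of_nonneg_left h1 two_pos.le) _).trans_eq h2.symm
  · have hs := (hT.summable_toLp hl hb).hasSum
    set ζ := ∑' n, (hT.memLp_term b n).toLp _
    have hζ : MemLp ζ 2 circleMeasure := Lp.memLp ζ
    refine ⟨ζ, (hasBoundarySum_iff hT hTf).2 ⟨hζ, (hT.tendsto_eLpNorm_iff hl hb hζ).2 ?_⟩⟩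
    rwa [Lp.toLp_coeFn]
  · obtain ⟨hξ2, hlim⟩ := (hasBoundarySum_iff hT hTf).1 hξ
    have hs := (hT.tendsto_eLpNorm_iff hl hb hξ2).1 hlim
    have hint : ∫ z, ‖ξ z‖ ^ 2 ∂circleMeasure = sigmaSq (deriv f 0) a :=
      (hT.integral_norm_sq_eq hl hb hξ2 hs).trans hσ.symm
    refine ⟨fun w hw => ?_, hint, fun t => ?_, hT.eLpNorm_four_le hl hb hξ2 hs⟩
    · have := hT.hasSum_poissonExtension hξ2 hs hw
      simpa only [poissonExtension_iterate hf hTm hT1 hr hw] using this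
    · rw [← hint]
      exact hT.integral_re_sq_eq hξ2 hs t
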